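/- Fix $0<R'<\tau$, $T\ge\tau+R'$ and $s\in(1,2)$. For $u\in L^2(0,T)$ and $\theta_0\in L^2(0,1)$, a solution of $$\theta_t-\theta_{xx}=0 \text{ on } (0,T)\times(0,1),\qquad \theta_x(t,0)=0,\qquad \theta_x(t,1)=u(t),\qquad \theta(0,\cdot)=\theta_0,$$ is a function $\theta\in C([0,T];L^2(0,1))$ with $\theta(0)=\theta_0$ such that for every $\varphi\in C^2([0,1])$ with $\varphi'(0)=\varphi'(1)=0$ and every $t\in[0,T]$, $$\int_0^1\theta(t,x)\varphi(x)\,dx=\int_0^1\theta_0\varphi\,dx+\int_0^t\Bigl(\int_0^1\theta(r,x)\varphi''(x)\,dx+u(r)\varphi(1)\Bigr)dr .$$ Let $\phi_s(t)=1$ for $t\le 0$, $\phi_s(t)=0$ for $t\ge 1$, and $\phi_s(t)=\dfrac{e^{-(1-t)^{-\kappa}}}{e^{-(1-t)^{-\kappa}}+e^{-t^{-\kappa}}}$ for $0<t<1$, where $\kappa=(s-1)^{-1}$. For $\theta_0\in L^2(0,1)$ with cosine expansion $\theta_0(x)=\sum_{n\ge0}c_n\sqrt2\cos(n\pi x)$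 in $L^2(0,1)$, put $$y_k=\sqrt2\Bigl(\sum_{n\ge0}c_ne^{-n^2\pi^2\tau}n^{2k}\Bigr)(-\pi^2)^k,\qquad y(t)=\phi_s\Bigl(\frac{t-\tau}{R'}\Bigr)\sum_{k\ge0}y_k\frac{(t-\tau)^k}{k!}$$ (so $y=0$ on $[\tau+R',T]$), and define the exact control by $u(t)=0$ for $0\le t\le\tau$ and $u(t)=\sum_{i\ge1}\frac{y^{(i)}(t)}{(2i-1)!}$ for $\tau<t\le T$. For $\bar\imath,\bar k,\bar n\in\mathbb N$ let $$\overline{y_k}=\sqrt2\Bigl(\sum_{0\le n\le\bar n}c_ne^{-n^2\pi^2\tau}n^{2k}\Bigr)(-\pi^2)^k,\qquad \overline y(t)=\phi_s\Bigl(\frac{t-\tau}{R'}\Bigr)\sum_{0\le k\le\bar k}\overline{y_k}\frac{(t-\tau)^k}{k!},$$ and define the truncated control by $\overline u(t)=0$ for $0\le t\le\tau$ and $\overline u(t)=\sum_{1\le i\le\bar\imath}\frac{\overline y^{(i)}(t)}{(2i-1)!}$ for $\tau<t\le T$. Then there exist positive constants $C,C_1,C_2,C_3$ (depending only on $T,\tau,R',s$)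 such that for all $\theta_0\in L^2(0,1)$: the series defining $y_k$ (for every $k$), $y$ (on $[\tau,\tau+R']$) and $u$ (on $[\tau,T]$) converge, $y$ is $C^\infty$ on $[\tau,T]$, and the system has a solution $\theta$ with control $u$ starting from $\theta_0$; and for all $\bar\imath,\bar k,\bar n\in\mathbb N$ it has a solution $\hat\theta$ with control $\overline u$ starting from $\theta_0$, and any such $\theta$ and $\hat\theta$ satisfy, for all $t\in[\tau,T]$, $$\|\theta(t)-\hat\theta(t)\|_{L^\infty(0,1)}\le C\left(e^{-C_1\,\bar\imath\ln\bar\imath}+e^{-C_2\,\bar k}+e^{-C_3\,\bar n^2}\right)\|\theta_0\|_{L^2(0,1)},$$ where $0\ln0=0$. -/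

import Mathlib

open MeasureTheory Set

noncomputable section

namespace HeatFlat

/-- Lebesgue measure on the interval `(0,1)`. -/
abbrev unitMeasure : Measure ℝ := volume.restrict (Ioo (0 : ℝ) 1)

/-- The real Hilbert space `L²(0,1)`. -/
abbrev L2 : Type := Lp ℝ 2 unitMeasure

/-- `θ` is the (weak) solution on `[0,T]` of the controlled heat equation
`θ_t = θ_xx` on `(0,T) × (0,1)`, `θ_x(t,0) = 0`, `θ_x(t,1) = u(t)`, `θ(0,·) = θ₀`,
with control `u ∈ L²(0,T)` and initial state `θ₀ ∈ L²(0,1)`: `θ ∈ C([0,T]; L²(0,1))`, `θ(0) = θ₀`,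
and the equation holds, integrated in time, against every `C²` test function `φ` on `[0,1]` with
`φ'(0) = φ'(1) = 0`. -/
structure IsHeatSolution (T : ℝ) (u : ℝ → ℝ) (θ₀ : L2) (θ : ℝ → L2) : Prop where
  control_memLp : MemLp u 2 (volume.restrict (Ioo (0 : ℝ) T))
  continuousOn : ContinuousOn θ (Icc 0 T)
  initial : θ 0 = θ₀
  weak : ∀ φ : ℝ → ℝ, ContDiff ℝ 2 φ → deriv φ 0 = 0 → deriv φ 1 = 0 → ∀ t ∈ Icc (0 : ℝ) T,
    ∫ x in Ioo (0 : ℝ) 1, θ t x * φ x =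
      (∫ x in Ioo (0 : ℝ) 1, θ₀ x * φ x) +
        ∫ r in (0 : ℝ)..t,
          ((∫ x in Ioo (0 : ℝ) 1, θ r x * deriv (deriv φ) x) + u r * φ 1)

/-- The Gevrey step function `φ_s`, with `k = (s - 1)⁻¹`. -/
def step (s t : ℝ) : ℝ :=
  if t ≤ 0 then 1
  else if 1 ≤ t then 0
  else Real.exp (-(1 - t) ^ (-(s - 1)⁻¹)) /
    (Real.exp (-(1 - t) ^ (-(s - 1)⁻¹)) + Real.exp (-t ^ (-(s - 1)⁻¹)))

/-- The coefficients `c_n` of the cosine expansion `θ₀ = ∑_{n ≥ 0} c_n √2 cos(nπx)` in `L²(0,1)`.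
The same factor `√2` is used for `n = 0`, hence the separate formula for `c_0`. -/
def cosCoeff (θ₀ : L2) (n : ℕ) : ℝ :=
  if n = 0 then (∫ x in Ioo (0 : ℝ) 1, θ₀ x) / √2
  else √2 * ∫ x in Ioo (0 : ℝ) 1, θ₀ x * Real.cos (n * Real.pi * x)

/-- The summand `c_n e^{-n²π²τ} n^{2k}` in the definition of `y_k`. -/
def outputCoeffTerm (τ : ℝ) (θ₀ : L2) (k n : ℕ) : ℝ :=
  cosCoeff θ₀ n * Real.exp (-(n : ℝ) ^ 2 * Real.pi ^ 2 * τ) * (n : ℝ) ^ (2 * k)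

/-- `y_k = √2 (∑_{n ≥ 0} c_n e^{-n²π²τ} n^{2k}) (-π²)^k`. -/
def outputCoeff (τ : ℝ) (θ₀ : L2) (k : ℕ) : ℝ :=
  √2 * (∑' n : ℕ, outputCoeffTerm τ θ₀ k n) * (-Real.pi ^ 2) ^ k

/-- The truncation of `y_k` to the modes `0 ≤ n ≤ N`. -/
def truncOutputCoeff (τ : ℝ) (θ₀ : L2) (N k : ℕ) : ℝ :=
  √2 * (∑ n ∈ Finset.range (N + 1), outputCoeffTerm τ θ₀ k n) * (-Real.pi ^ 2) ^ k

/-- The flat output `y(t) = φ_s((t-τ)/R') ∑_{k ≥ 0} y_k (t-τ)^k / k!`; it vanishes for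
`t ≥ τ + R'` because the step function does. -/
def flatOutput (s τ R' : ℝ) (θ₀ : L2) (t : ℝ) : ℝ :=
  step s ((t - τ) / R') * ∑' k : ℕ, outputCoeff τ θ₀ k * (t - τ) ^ k / (k.factorial : ℝ)

/-- The truncated flat output, with `0 ≤ k ≤ K` and `y_k` truncated to `0 ≤ n ≤ N`. -/
def truncFlatOutput (s τ R' : ℝ) (θ₀ : L2) (K N : ℕ) (t : ℝ) : ℝ :=
  step s ((t - τ) / R') *
    ∑ k ∈ Finset.range (K + 1), truncOutputCoeff τ θ₀ N k * (t - τ) ^ k / (k.factorial : ℝ)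

/-- The exact control: `0` up to time `τ`, then `∑_{i ≥ 1} y^{(i)}(t) / (2i-1)!`
(the index is shifted by one). -/
def control (s τ R' : ℝ) (θ₀ : L2) (t : ℝ) : ℝ :=
  if t ≤ τ then 0
  else ∑' i : ℕ, iteratedDeriv (i + 1) (flatOutput s τ R' θ₀) t / ((2 * i + 1).factorial : ℝ)

/-- The truncated control: `0` up to time `τ`, then `∑_{1 ≤ i ≤ I} ȳ^{(i)}(t) / (2i-1)!`, where
`ȳ` is the truncated flat output (the index is shifted by one). -/
def truncControl (s τ R' : ℝ) (θ₀ : L2) (I K N : ℕ) (t : ℝ) : ℝ :=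
  if t ≤ τ then 0
  else ∑ i ∈ Finset.range I,
    iteratedDeriv (i + 1) (truncFlatOutput s τ R' θ₀ K N) t / ((2 * i + 1).factorial : ℝ)

/-- The exact control is given by genuinely convergent series and genuine derivatives. -/
structure ControlWellDefined (T s τ R' : ℝ) (θ₀ : L2) : Prop where
  summable_coeff : ∀ k : ℕ, Summable (outputCoeffTerm τ θ₀ k)
  summable_output : ∀ t ∈ Icc τ (τ + R'),
    Summable fun k : ℕ => outputCoeff τ θ₀ k * (t - τ) ^ k / (k.factorial : ℝ)
  smooth_output : ∀ t ∈ Icc τ T, ContDiffAt ℝ (⊤ : ℕ∞) (flatOutput s τ R' θ₀) t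
  summable_control : ∀ t ∈ Icc τ T, Summable fun i : ℕ =>
    iteratedDeriv (i + 1) (flatOutput s τ R' θ₀) t / ((2 * i + 1).factorial : ℝ)

end HeatFlat

end

/-!
Write `κ = (s - 1)⁻¹`. On `(0, 1)` the function `1 - φ_s(t)` is
`1 / (1 + exp (t ^ (-κ) - (1 - t) ^ (-κ)))`, which extends holomorphically to discs around `t` of
radius proportional to `t`, where it is at most a multiple of `exp (-t ^ (-κ) / 2)`. Cauchy's
estimates, with this decay absorbing the powers of `1 / t`, show that `φ_s` is Gevrey of order
`1 + κ⁻¹ = s`. Since `R' < τ`, the Taylor series of the flat output has radius of convergence larger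
than `R'`, so the flat output is Gevrey of order `s < 2`: the factorials `(2 i - 1)!` win, and the
tail of the control series beyond `I` is of size `exp (-C₁ I log I)`. Truncating the Taylor series
costs a geometric factor in `K`, and truncating the modes costs a Gaussian factor in `N`, taken from
part of `exp (-n² π² τ)`. Finally, the `n`-th cosine coefficient of the difference of two solutions
with the same initial state solves a scalar equation driven by the difference of the controls, and
is bounded by a multiple of `1 / (1 + n² π²)`, which is summable; this gives the `L^∞` bound.
-/

noncomputable section

namespace HeatFlat

open Filter Topology

/-! ### The cosine basis -/

section Continuous

variable {g : ℝ → ℝ}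

theorem memLp_of_continuous (hg : Continuous g) : MemLp g 2 unitMeasure := by
  obtain ⟨C, hC⟩ := isCompact_Icc.exists_bound_of_continuousOn
    (hg.continuousOn (s := Icc (0 : ℝ) 1))
  exact .of_bound hg.aestronglyMeasurable C
    ((ae_restrict_iff' measurableSet_Ioo).2 (Eventually.of_forall fun x hx =>
      hC x (Ioo_subset_Icc_self hx)))

theorem inner_toLp (f : L2) (hg : MemLp g 2 unitMeasure) :
    inner ℝ (hg.toLp g) f = ∫ x in Ioo (0 : ℝ) 1, f x * g x := by
  rw [L2.inner_def]
  refine integral_congr_ae ?_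
  filter_upwards [hg.coeFn_toLp] with x hx
  rw [hx]
  simp

theorem integrableOn_mul_continuous (f : L2) (hg : Continuous g) :
    IntegrableOn (fun x => f x * g x) (Ioo (0 : ℝ) 1) :=
  (Lp.memLp f).integrable_mul (memLp_of_continuous hg)

theorem exists_polynomial_cos_near (hg : Continuous g) {ε : ℝ} (hε : 0 < ε) :
    ∃ p : Polynomial ℝ, ∀ x ∈ Icc (0 : ℝ) 1, |g x - p.eval (Real.cos (Real.pi * x))| < ε := by
  obtain ⟨p, hp⟩ := exists_polynomial_near_of_continuousOn (-1) 1
    (fun y => g (Real.arccos y / Real.pi))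
    (hg.comp (Real.continuous_arccos.div_const _)).continuousOn ε hε
  refine ⟨p, fun x hx => ?_⟩
  have h := hp (Real.cos (Real.pi * x)) ⟨Real.neg_one_le_cos _, Real.cos_le_one _⟩
  rwa [Real.arccos_cos (mul_nonneg Real.pi_pos.le hx.1)
    (mul_le_of_le_one_right Real.pi_pos.le hx.2), mul_div_cancel_left₀ _ Real.pi_ne_zero,
    abs_sub_comm] at h

end Continuous

section Completeness

variable {f : L2} (hf : ∀ m : ℤ, ∫ x in Ioo (0 : ℝ) 1, f x * Real.cos (m * Real.pi * x) = 0)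
include hf

theorem integral_mul_cos_mul_cos_pow_eq_zero (k : ℕ) (m : ℤ) : ∫ x in Ioo (0 : ℝ) 1,
    f x * (Real.cos (m * Real.pi * x) * Real.cos (Real.pi * x) ^ k) = 0 := by
  induction k generalizing m with
  | zero => simpa using hf m
  | succ k ih =>
    have hint (m : ℤ) : IntegrableOn (fun x => f x *
        (Real.cos (m * Real.pi * x) * Real.cos (Real.pi * x) ^ k)) (Ioo (0 : ℝ) 1) :=
      integrableOn_mul_continuous f (by fun_prop)
    have hcos (x : ℝ) :
        f x * (Real.cos (m * Real.pi * x) * Real.cos (Real.pi * x) ^ (k + 1)) =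
          (f x * (Real.cos ((m + 1 : ℤ) * Real.pi * x) * Real.cos (Real.pi * x) ^ k) +
            f x * (Real.cos ((m - 1 : ℤ) * Real.pi * x) * Real.cos (Real.pi * x) ^ k)) / 2 := by
      rw [show ((m + 1 : ℤ) : ℝ) * Real.pi * x = m * Real.pi * x + Real.pi * x by push_cast; ring,
        show ((m - 1 : ℤ) : ℝ) * Real.pi * x = m * Real.pi * x - Real.pi * x by push_cast; ring,
        Real.cos_sub, Real.cos_add]
      ring
    simp only [hcos]
    rw [integral_div, integral_add (hint _) (hint _), ih, ih, add_zero, zero_div]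

theorem integral_mul_polynomial_cos_eq_zero (p : Polynomial ℝ) :
    ∫ x in Ioo (0 : ℝ) 1, f x * p.eval (Real.cos (Real.pi * x)) = 0 := by
  induction p using Polynomial.induction_on' with
  | add p q hp hq =>
    simp only [Polynomial.eval_add, mul_add]
    rw [integral_add (integrableOn_mul_continuous f (by fun_prop))
      (integrableOn_mul_continuous f (by fun_prop)), hp, hq, add_zero]
  | monomial k a =>
    have hpow := integral_mul_cos_mul_cos_pow_eq_zero hf k 0
    simp only [Int.cast_zero, zero_mul, Real.cos_zero, one_mul] at hpow
    simp only [Polynomial.eval_monomial, mul_left_comm _ a]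
    rw [integral_const_mul, hpow, mul_zero]

theorem integral_mul_continuous_eq_zero {g : ℝ → ℝ} (hg : Continuous g) :
    ∫ x in Ioo (0 : ℝ) 1, f x * g x = 0 := by
  have hfi : IntegrableOn (fun x => f x) (Ioo (0 : ℝ) 1) := (Lp.memLp f).integrable one_le_two
  set J := ∫ x in Ioo (0 : ℝ) 1, |f x|
  have : 0 ≤ J := integral_nonneg fun x => abs_nonneg _
  have hbound (ε : ℝ) (hε : 0 < ε) : |∫ x in Ioo (0 : ℝ) 1, f x * g x| ≤ ε * J := by
    obtain ⟨p, hp⟩ := exists_polynomial_cos_near hg hε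
    have hsub : ∫ x in Ioo (0 : ℝ) 1, f x * g x =
        ∫ x in Ioo (0 : ℝ) 1, f x * (g x - p.eval (Real.cos (Real.pi * x))) := by
      simp only [mul_sub]
      rw [integral_sub (integrableOn_mul_continuous f hg)
        (integrableOn_mul_continuous f (by fun_prop)), integral_mul_polynomial_cos_eq_zero hf,
        sub_zero]
    rw [hsub, ← integral_const_mul, ← Real.norm_eq_abs]
    refine norm_integral_le_of_norm_le (hfi.abs.const_mul ε)
      ((ae_restrict_iff' measurableSet_Ioo).2 (Eventually.of_forall fun x hx => ?_))
    rw [norm_mul, Real.norm_eq_abs, Real.norm_eq_abs, mul_comm]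
    gcongr
    exact (hp x (Ioo_subset_Icc_self hx)).le
  refine abs_nonpos_iff.1 (le_of_forall_pos_le_add fun ε hε => ?_)
  refine (hbound (ε / (J + 1)) (by positivity)).trans ?_
  rw [zero_add, div_mul_eq_mul_div, div_le_iff₀ (by positivity)]
  nlinarith

theorem eq_zero_of_integral_mul_cos_eq_zero : f = 0 := by
  have hdense := BoundedContinuousFunction.toLp_denseRange ℝ unitMeasure (p := 2) ℝ
    ENNReal.ofNat_ne_top
  refine Dense.eq_zero_of_inner_left ℝ hdense ?_
  rintro _ ⟨g, rfl⟩
  rw [real_inner_comm]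
  exact (inner_toLp f (memLp_of_continuous g.continuous)).trans
    (integral_mul_continuous_eq_zero hf g.continuous)

end Completeness

/-- The normalizing factor of the `n`-th cosine in `L²(0,1)`. -/
def modeScale (n : ℕ) : ℝ := if n = 0 then 1 else √2

/-- The orthonormal cosines `1, √2 cos(nπx)`. -/
def cosMode (n : ℕ) (x : ℝ) : ℝ := modeScale n * Real.cos (n * Real.pi * x)

theorem modeScale_pos (n : ℕ) : 0 < modeScale n := by
  rw [modeScale]
  split_ifs <;> positivity

theorem continuous_cosMode (n : ℕ) : Continuous (cosMode n) := by
  unfold cosMode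
  fun_prop

theorem abs_cosMode_le (n : ℕ) (x : ℝ) : |cosMode n x| ≤ √2 := by
  have hscale : modeScale n ≤ √2 := by
    rw [modeScale]
    split_ifs
    exacts [Real.one_le_sqrt.2 one_le_two, le_rfl]
  rw [cosMode, abs_mul, abs_of_pos (modeScale_pos n)]
  exact (mul_le_of_le_one_right (modeScale_pos n).le (Real.abs_cos_le_one _)).trans hscale

theorem integral_cos_int_mul_pi (k : ℤ) :
    ∫ x in Ioo (0 : ℝ) 1, Real.cos (k * Real.pi * x) = if k = 0 then 1 else 0 := by
  rw [← integral_Ioc_eq_integral_Ioo, ← intervalIntegral.integral_of_le zero_le_one]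
  split_ifs with hk
  · simp [hk]
  · have hkπ : (k : ℝ) * Real.pi ≠ 0 := mul_ne_zero (mod_cast hk) Real.pi_ne_zero
    rw [intervalIntegral.integral_comp_mul_left (fun x => Real.cos x) hkπ, integral_cos]
    simp [Real.sin_int_mul_pi]

theorem integral_cosMode_mul_cosMode (n m : ℕ) :
    ∫ x in Ioo (0 : ℝ) 1, cosMode n x * cosMode m x = if n = m then 1 else 0 := by
  have hint (k : ℤ) : IntegrableOn (fun x : ℝ => Real.cos (k * Real.pi * x)) (Ioo (0 : ℝ) 1) :=
    (memLp_of_continuous (by fun_prop)).integrable one_le_two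
  have hprod (x : ℝ) : cosMode n x * cosMode m x = modeScale n * modeScale m / 2 *
      (Real.cos ((n - m : ℤ) * Real.pi * x) + Real.cos ((n + m : ℤ) * Real.pi * x)) := by
    rw [show ((n - m : ℤ) : ℝ) * Real.pi * x = n * Real.pi * x - m * Real.pi * x by
        push_cast; ring,
      show ((n + m : ℤ) : ℝ) * Real.pi * x = n * Real.pi * x + m * Real.pi * x by push_cast; ring,
      Real.cos_sub, Real.cos_add, cosMode, cosMode]
    ring
  simp only [hprod]
  rw [integral_const_mul, integral_add (hint _) (hint _), integral_cos_int_mul_pi,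
    integral_cos_int_mul_pi]
  rcases eq_or_ne n m with rfl | hnm
  · rcases eq_or_ne n 0 with rfl | hn
    · norm_num [modeScale]
    · have : (n : ℤ) + n ≠ 0 := by omega
      simp [modeScale, hn, this]
  · rw [if_neg (by omega), if_neg (by omega), if_neg hnm]
    simp

/-- The coordinates of `g` in the cosine basis. -/
def modeCoeff (g : ℝ → ℝ) (n : ℕ) : ℝ := ∫ x in Ioo (0 : ℝ) 1, g x * cosMode n x

theorem modeCoeff_eq (g : ℝ → ℝ) (n : ℕ) : modeCoeff g n =
    modeScale n * ∫ x in Ioo (0 : ℝ) 1, g x * Real.cos (n * Real.pi * x) := by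
  simp only [modeCoeff, cosMode, mul_left_comm _ (modeScale n)]
  rw [integral_const_mul]

theorem modeCoeff_toLp {g : ℝ → ℝ} (hg : MemLp g 2 unitMeasure) (n : ℕ) :
    modeCoeff (hg.toLp g) n = modeCoeff g n := by
  refine integral_congr_ae ?_
  filter_upwards [hg.coeFn_toLp] with x hx
  rw [hx]

/-- The orthonormal cosines as elements of `L²(0,1)`. -/
def modeVec (n : ℕ) : L2 := (memLp_of_continuous (continuous_cosMode n)).toLp _

theorem inner_modeVec (n : ℕ) (f : L2) : inner ℝ (modeVec n) f = modeCoeff f n := inner_toLp f _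

theorem orthonormal_modeVec : Orthonormal ℝ modeVec := by
  rw [orthonormal_iff_ite]
  intro n m
  rw [inner_modeVec, modeVec, modeCoeff_toLp, modeCoeff, integral_cosMode_mul_cosMode]
  exact if_congr eq_comm rfl rfl

theorem eq_zero_of_modeCoeff_eq_zero {f : L2} (hf : ∀ n, modeCoeff f n = 0) : f = 0 := by
  refine eq_zero_of_integral_mul_cos_eq_zero fun m => ?_
  have hcos (x : ℝ) : Real.cos (m * Real.pi * x) = Real.cos (m.natAbs * Real.pi * x) := by
    rcases m.natAbs_eq with h | h <;> rw [h] <;> simp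
  have hm := hf m.natAbs
  rw [modeCoeff_eq] at hm
  simpa only [hcos] using (mul_eq_zero.1 hm).resolve_left (modeScale_pos _).ne'

/-- The Hilbert basis of cosines of `L²(0,1)`. -/
def cosBasis : HilbertBasis ℕ ℝ L2 :=
  HilbertBasis.mkOfOrthogonalEqBot orthonormal_modeVec <| (Submodule.eq_bot_iff _).2 fun f hf =>
    eq_zero_of_modeCoeff_eq_zero fun n => (inner_modeVec n f).symm.trans
      ((Submodule.mem_orthogonal _ _).1 hf _ (Submodule.subset_span ⟨n, rfl⟩))

theorem inner_cosBasis (f : L2) (n : ℕ) : inner ℝ (cosBasis n) f = modeCoeff f n := by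
  rw [cosBasis, HilbertBasis.coe_mkOfOrthogonalEqBot, inner_modeVec]

theorem repr_cosBasis (f : L2) (n : ℕ) : cosBasis.repr f n = modeCoeff f n := by
  rw [HilbertBasis.repr_apply_apply, inner_cosBasis]

theorem eq_of_modeCoeff_eq {f g : L2} (h : ∀ n, modeCoeff f n = modeCoeff g n) : f = g := by
  refine cosBasis.repr.injective (lp.ext (funext fun n => ?_))
  rw [repr_cosBasis, repr_cosBasis, h]

theorem abs_modeCoeff_le (f : L2) (n : ℕ) : |modeCoeff f n| ≤ ‖f‖ := by
  rw [← inner_cosBasis]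
  refine (abs_real_inner_le_norm _ _).trans_eq ?_
  rw [cosBasis.orthonormal.1 n, one_mul]

theorem abs_cosCoeff_le (f : L2) (n : ℕ) : |cosCoeff f n| ≤ ‖f‖ := by
  refine le_trans ?_ (abs_modeCoeff_le f n)
  rw [cosCoeff, modeCoeff_eq, modeScale]
  split_ifs with hn
  · simpa [hn, abs_div, abs_of_nonneg] using div_le_self (abs_nonneg (∫ x in Ioo (0 : ℝ) 1, f x))
      (Real.one_le_sqrt.2 one_le_two)
  · exact le_rfl

theorem modeCoeff_sub (f g : L2) (n : ℕ) :
    modeCoeff (f - g : L2) n = modeCoeff f n - modeCoeff g n := by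
  simp only [← inner_cosBasis, inner_sub_right]

theorem hasSum_modeCoeff_sq (f : L2) : HasSum (fun n => modeCoeff f n ^ 2) (‖f‖ ^ 2) := by
  rw [← real_inner_self_eq_norm_sq]
  refine (cosBasis.hasSum_inner_mul_inner f f).congr_fun fun n => ?_
  rw [real_inner_comm, inner_cosBasis, sq]

theorem hasSum_modeCoeff_mul_modeCoeff (f : L2) {g : ℝ → ℝ} (hg : Continuous g) :
    HasSum (fun n => modeCoeff f n * modeCoeff g n) (∫ x in Ioo (0 : ℝ) 1, f x * g x) := by
  have hsum := cosBasis.hasSum_inner_mul_inner ((memLp_of_continuous hg).toLp g) f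
  rw [inner_toLp] at hsum
  refine hsum.congr_fun fun n => ?_
  rw [real_inner_comm, inner_cosBasis, inner_cosBasis, modeCoeff_toLp, mul_comm]

theorem exists_modeCoeff_eq {a : ℕ → ℝ} (ha : Summable fun n => a n ^ 2) :
    ∃ f : L2, ∀ n, modeCoeff f n = a n := by
  have hmem : Memℓp a 2 := memℓp_gen (by simpa using ha)
  refine ⟨cosBasis.repr.symm ⟨a, hmem⟩, fun n => ?_⟩
  rw [← repr_cosBasis, LinearIsometryEquiv.apply_symm_apply]

theorem continuous_cosSeries {c : ℕ → ℝ} (hc : Summable fun n => |c n|) :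
    Continuous fun x => ∑' n, c n * cosMode n x := by
  refine continuous_tsum (fun n => continuous_const.mul (continuous_cosMode n))
    (hc.mul_right √2) fun n x => ?_
  rw [norm_mul]
  exact mul_le_mul_of_nonneg_left (abs_cosMode_le n x) (abs_nonneg _)

theorem modeCoeff_cosSeries {c : ℕ → ℝ} (hc : Summable fun n => |c n|) (m : ℕ) :
    modeCoeff (fun x => ∑' n, c n * cosMode n x) m = c m := by
  have hint (n : ℕ) : Integrable (fun x => c n * cosMode n x * cosMode m x) unitMeasure :=
    (memLp_of_continuous ((continuous_const.mul (continuous_cosMode n)).mul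
      (continuous_cosMode m))).integrable one_le_two
  have hnorm (n : ℕ) : ∫ x in Ioo (0 : ℝ) 1, ‖c n * cosMode n x * cosMode m x‖ ≤
      |c n| * √2 * √2 :=
    calc ∫ x in Ioo (0 : ℝ) 1, ‖c n * cosMode n x * cosMode m x‖
        ≤ ∫ _ in Ioo (0 : ℝ) 1, |c n| * √2 * √2 := by
          refine integral_mono (hint n).norm (integrable_const _) fun x => ?_
          simp only [norm_mul, Real.norm_eq_abs]
          gcongr <;> exact abs_cosMode_le _ x
      _ = |c n| * √2 * √2 := by simp
  have hsum := hasSum_integral_of_summable_integral_norm hint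
    (((hc.mul_right √2).mul_right √2).of_nonneg_of_le
      (fun n => integral_nonneg fun x => norm_nonneg _) hnorm)
  simp only [mul_assoc, integral_const_mul, integral_cosMode_mul_cosMode] at hsum
  have hsingle : HasSum (fun n => c n * if n = m then (1 : ℝ) else 0) (c m) := by
    simpa using hasSum_single (f := fun n => c n * if n = m then (1 : ℝ) else 0) m
      fun n hn => by simp [hn]
  rw [hsingle.unique hsum]
  simp only [modeCoeff, ← tsum_mul_right, mul_assoc]

theorem ae_eq_cosSeries {f : L2} (hf : Summable fun n => |modeCoeff f n|) :
    f =ᵐ[unitMeasure] fun x => ∑' n, modeCoeff f n * cosMode n x := by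
  have hcont := continuous_cosSeries hf
  have heq : f = (memLp_of_continuous hcont).toLp _ := eq_of_modeCoeff_eq fun m => by
    rw [modeCoeff_toLp, modeCoeff_cosSeries hf]
  have hae := (memLp_of_continuous hcont).coeFn_toLp
  rwa [← heq] at hae

theorem eq_cosSeries {g : ℝ → ℝ} (hg : Continuous g) (hs : Summable fun n => |modeCoeff g n|)
    {x : ℝ} (hx : x ∈ Icc (0 : ℝ) 1) : g x = ∑' n, modeCoeff g n * cosMode n x := by
  have hL2 := memLp_of_continuous hg
  have hseries := ae_eq_cosSeries (f := hL2.toLp g) (by simpa only [modeCoeff_toLp] using hs)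
  simp only [modeCoeff_toLp] at hseries
  have hae : g =ᵐ[volume.restrict (Icc (0 : ℝ) 1)] fun x => ∑' n, modeCoeff g n * cosMode n x := by
    rw [← restrict_Ioo_eq_restrict_Icc]
    exact hL2.coeFn_toLp.symm.trans hseries
  exact Measure.eqOn_Icc_of_ae_eq volume zero_ne_one hae hg.continuousOn
    (continuous_cosSeries hs).continuousOn hx

/-! ### The Neumann Laplacian -/

/-- The Neumann eigenvalue `n²π²`. -/
def eigen (n : ℕ) : ℝ := ((n : ℝ) * Real.pi) ^ 2

theorem eigen_nonneg (n : ℕ) : 0 ≤ eigen n := sq_nonneg _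

theorem one_add_eigen_pos (n : ℕ) : 0 < 1 + eigen n := by
  linarith [eigen_nonneg n]

theorem summable_one_add_eigen_inv : Summable fun n => (1 + eigen n)⁻¹ := by
  refine (summable_nat_add_iff 1).1 (Summable.of_nonneg_of_le
    (fun n => (inv_pos.2 (one_add_eigen_pos _)).le) (fun n => ?_)
    ((summable_nat_add_iff 1).2 (Real.summable_nat_pow_inv.2 one_lt_two)))
  have hπ : 1 ≤ Real.pi := by linarith [Real.pi_gt_three]
  gcongr
  rw [eigen, mul_pow]
  nlinarith [one_le_pow₀ hπ (n := 2), sq_nonneg ((n + 1 : ℕ) : ℝ)]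

theorem hasDerivAt_cosMode (n : ℕ) (x : ℝ) :
    HasDerivAt (cosMode n) (modeScale n * (-Real.sin (n * Real.pi * x) * (n * Real.pi))) x :=
  ((hasDerivAt_const_mul ((n : ℝ) * Real.pi)).cos.const_mul (modeScale n))

theorem deriv_cosMode (n : ℕ) :
    deriv (cosMode n) = fun x => modeScale n * (-Real.sin (n * Real.pi * x) * (n * Real.pi)) :=
  funext fun x => (hasDerivAt_cosMode n x).deriv

theorem hasDerivAt_deriv_cosMode (n : ℕ) (x : ℝ) :
    HasDerivAt (deriv (cosMode n)) (-eigen n * cosMode n x) x := by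
  rw [deriv_cosMode]
  refine (((hasDerivAt_const_mul ((n : ℝ) * Real.pi)).sin.neg.mul_const
    ((n : ℝ) * Real.pi)).const_mul (modeScale n)).congr_deriv ?_
  rw [cosMode, eigen]
  ring

theorem contDiff_cosMode (n : ℕ) : ContDiff ℝ 2 (cosMode n) := by
  unfold cosMode
  fun_prop

theorem deriv_cosMode_zero (n : ℕ) : deriv (cosMode n) 0 = 0 := by
  simp [deriv_cosMode]

theorem deriv_cosMode_one (n : ℕ) : deriv (cosMode n) 1 = 0 := by
  simp [deriv_cosMode, Real.sin_nat_mul_pi]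

/-- Test functions of the weak formulation. -/
structure IsNeumann (φ : ℝ → ℝ) : Prop where
  contDiff : ContDiff ℝ 2 φ
  deriv_zero : deriv φ 0 = 0
  deriv_one : deriv φ 1 = 0

theorem isNeumann_cosMode (n : ℕ) : IsNeumann (cosMode n) :=
  ⟨contDiff_cosMode n, deriv_cosMode_zero n, deriv_cosMode_one n⟩

namespace IsNeumann

variable {φ ψ : ℝ → ℝ}

theorem contDiff_deriv (hφ : IsNeumann φ) : ContDiff ℝ 1 (deriv φ) :=
  ((contDiff_succ_iff_deriv (n := 1)).1 (by simpa only [one_add_one_eq_two] using hφ.contDiff)).2.2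

theorem continuous_deriv_deriv (hφ : IsNeumann φ) : Continuous (deriv (deriv φ)) :=
  hφ.contDiff_deriv.continuous_deriv le_rfl

theorem integral_deriv_deriv_mul (hφ : IsNeumann φ) (hψ : ContDiff ℝ 1 ψ) :
    ∫ x in (0 : ℝ)..1, deriv (deriv φ) x * ψ x = -∫ x in (0 : ℝ)..1, deriv φ x * deriv ψ x := by
  have hparts := intervalIntegral.integral_deriv_mul_eq_sub (a := 0) (b := 1)
    (fun x _ => (hφ.contDiff_deriv.differentiable one_ne_zero x).hasDerivAt)
    (fun x _ => (hψ.differentiable one_ne_zero x).hasDerivAt)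
    (hφ.continuous_deriv_deriv.intervalIntegrable 0 1)
    ((hψ.continuous_deriv le_rfl).intervalIntegrable 0 1)
  have hsplit := intervalIntegral.integral_add
    ((hφ.continuous_deriv_deriv.fun_mul hψ.continuous).intervalIntegrable (μ := volume) 0 1)
    ((hφ.contDiff_deriv.continuous.fun_mul (hψ.continuous_deriv le_rfl)).intervalIntegrable 0 1)
  rw [hsplit, hφ.deriv_zero, hφ.deriv_one] at hparts
  linarith

theorem modeCoeff_deriv_deriv (hφ : IsNeumann φ) (n : ℕ) :
    modeCoeff (deriv (deriv φ)) n = -eigen n * modeCoeff φ n := by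
  have hφ1 : ContDiff ℝ 1 φ := hφ.contDiff.of_le one_le_two
  have hgreen : ∫ x in (0 : ℝ)..1, deriv (deriv φ) x * cosMode n x =
      ∫ x in (0 : ℝ)..1, deriv (deriv (cosMode n)) x * φ x := by
    rw [hφ.integral_deriv_deriv_mul ((contDiff_cosMode n).of_le one_le_two),
      (isNeumann_cosMode n).integral_deriv_deriv_mul hφ1]
    simp only [mul_comm]
  simp only [(hasDerivAt_deriv_cosMode n _).deriv, mul_assoc] at hgreen
  rw [intervalIntegral.integral_const_mul, intervalIntegral.integral_of_le zero_le_one,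
    intervalIntegral.integral_of_le zero_le_one, integral_Ioc_eq_integral_Ioo,
    integral_Ioc_eq_integral_Ioo] at hgreen
  simpa only [modeCoeff, mul_comm (φ _)] using hgreen

theorem summable_abs_modeCoeff (hφ : IsNeumann φ) : Summable fun n => |modeCoeff φ n| := by
  have hφL := memLp_of_continuous hφ.contDiff.continuous
  have hφL'' := memLp_of_continuous hφ.continuous_deriv_deriv
  refine Summable.of_nonneg_of_le (fun n => abs_nonneg _) (fun n => ?_)
    (summable_one_add_eigen_inv.mul_left (‖hφL.toLp φ‖ + ‖hφL''.toLp (deriv (deriv φ))‖))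
  have hcoeff := abs_modeCoeff_le (hφL.toLp φ) n
  have hcoeff'' := abs_modeCoeff_le (hφL''.toLp (deriv (deriv φ))) n
  rw [modeCoeff_toLp] at hcoeff hcoeff''
  rw [hφ.modeCoeff_deriv_deriv, abs_mul, abs_neg, abs_of_nonneg (eigen_nonneg n)] at hcoeff''
  rw [← div_eq_mul_inv, le_div_iff₀ (one_add_eigen_pos n)]
  linarith

end IsNeumann

section Gevrey

open scoped Nat

/-! ### Pointwise Gevrey estimates -/

/-- `f` is smooth at `x` and its derivatives at `x` satisfy the estimate of the Gevrey class of
order `s` with explicit constants `A` and `M`. Keeping the constants explicit lets a family of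
functions be controlled uniformly. -/
structure GevreyAt (s A M : ℝ) (f : ℝ → ℝ) (x : ℝ) : Prop where
  contDiffAt : ContDiffAt ℝ (⊤ : ℕ∞) f x
  abs_iteratedDeriv_le : ∀ k : ℕ, |iteratedDeriv k f x| ≤ A * M ^ k * (k ! : ℝ) ^ s

namespace GevreyAt

variable {s s' A A' B M M' N x : ℝ} {f g : ℝ → ℝ}

theorem nonneg (h : GevreyAt s A M f x) : 0 ≤ A := by
  simpa using (abs_nonneg _).trans (h.abs_iteratedDeriv_le 0)

theorem mono (h : GevreyAt s A M f x) (hs : s ≤ s') (hA : A ≤ A') (hM : 0 ≤ M) (hMM' : M ≤ M') :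
    GevreyAt s' A' M' f x where
  contDiffAt := h.contDiffAt
  abs_iteratedDeriv_le k := by
    have hA' : 0 ≤ A' := h.nonneg.trans hA
    have hM' : 0 ≤ M' := hM.trans hMM'
    have hk : (1 : ℝ) ≤ k ! := mod_cast k.factorial_pos
    refine (h.abs_iteratedDeriv_le k).trans ?_
    gcongr

theorem congr_of_eventuallyEq (h : GevreyAt s A M f x) (hg : g =ᶠ[𝓝 x] f) :
    GevreyAt s A M g x where
  contDiffAt := h.contDiffAt.congr_of_eventuallyEq hg
  abs_iteratedDeriv_le k := by
    rw [hg.iteratedDeriv_eq k]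
    exact h.abs_iteratedDeriv_le k

theorem of_eventuallyEq_zero (hA : 0 ≤ A) (hM : 0 ≤ M) (hf : f =ᶠ[𝓝 x] fun _ => 0) :
    GevreyAt s A M f x := by
  refine GevreyAt.congr_of_eventuallyEq ⟨contDiffAt_const, fun k => ?_⟩ hf
  rw [iteratedDeriv_const, ite_self, abs_zero]
  positivity

theorem const_sub (c : ℝ) (h : GevreyAt s A M f x) (hM : 0 ≤ M) :
    GevreyAt s (|c| + A) M (fun t => c - f t) x where
  contDiffAt := contDiffAt_const.sub h.contDiffAt
  abs_iteratedDeriv_le k := by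
    have hk := h.abs_iteratedDeriv_le k
    rcases k.eq_zero_or_pos with rfl | hpos
    · simp only [iteratedDeriv_zero, pow_zero, mul_one, Nat.factorial_zero, Nat.cast_one,
        Real.one_rpow] at hk ⊢
      exact (abs_sub _ _).trans (by gcongr)
    · rw [iteratedDeriv_const_sub hpos, iteratedDeriv_neg, abs_neg]
      refine hk.trans ?_
      gcongr
      exact le_add_of_nonneg_left (abs_nonneg c)

theorem mul (hf : GevreyAt s A M f x) (hg : GevreyAt s B N g x) (hs : 0 ≤ s) (hM : 0 ≤ M)
    (hN : 0 ≤ N) : GevreyAt s (A * B) (M + N) (fun t => f t * g t) x where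
  contDiffAt := hf.contDiffAt.mul hg.contDiffAt
  abs_iteratedDeriv_le k := by
    have hA := hf.nonneg
    have hB := hg.nonneg
    rw [iteratedDeriv_fun_mul (hf.contDiffAt.of_le (mod_cast le_top))
      (hg.contDiffAt.of_le (mod_cast le_top)), add_pow, Finset.mul_sum, Finset.sum_mul]
    refine (Finset.abs_sum_le_sum_abs _ _).trans (Finset.sum_le_sum fun j hj => ?_)
    have hfact : (j ! : ℝ) ^ s * ((k - j)! : ℝ) ^ s ≤ (k ! : ℝ) ^ s := by
      rw [← Real.mul_rpow (by positivity) (by positivity)]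
      gcongr
      exact_mod_cast Nat.le_of_dvd k.factorial_pos
        (Nat.factorial_mul_factorial_dvd_factorial (Finset.mem_range_succ_iff.1 hj))
    rw [abs_mul, abs_mul, Nat.abs_cast]
    calc (k.choose j : ℝ) * |iteratedDeriv j f x| * |iteratedDeriv (k - j) g x|
        ≤ k.choose j * (A * M ^ j * (j ! : ℝ) ^ s) * (B * N ^ (k - j) * ((k - j)! : ℝ) ^ s) := by
          gcongr
          · exact hf.abs_iteratedDeriv_le j
          · exact hg.abs_iteratedDeriv_le (k - j)
      _ = A * B * (M ^ j * N ^ (k - j) * k.choose j) * ((j ! : ℝ) ^ s * ((k - j)! : ℝ) ^ s) := by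
          ring
      _ ≤ A * B * (M ^ j * N ^ (k - j) * k.choose j) * (k ! : ℝ) ^ s := by gcongr

end GevreyAt

theorem iteratedDeriv_comp_affine (f : ℝ → ℝ) (a b : ℝ) (k : ℕ) :
    iteratedDeriv k (fun t => f (a * t + b)) = fun t => a ^ k * iteratedDeriv k f (a * t + b) := by
  induction k with
  | zero => simp
  | succ k ih =>
    ext t
    rw [iteratedDeriv_succ, ih, deriv_const_mul_field,
      deriv_comp_mul_left a (fun u => iteratedDeriv k f (u + b)), deriv_comp_add_const,
      iteratedDeriv_succ, smul_eq_mul, pow_succ, mul_assoc]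

theorem GevreyAt.comp_affine {s A M a b x : ℝ} {f : ℝ → ℝ} (h : GevreyAt s A M f (a * x + b)) :
    GevreyAt s A (|a| * M) (fun t => f (a * t + b)) x where
  contDiffAt := h.contDiffAt.comp (g := f) (f := fun t => a * t + b) x (by fun_prop)
  abs_iteratedDeriv_le k := by
    rw [iteratedDeriv_comp_affine, abs_mul, abs_pow, mul_pow]
    calc |a| ^ k * |iteratedDeriv k f (a * x + b)|
        ≤ |a| ^ k * (A * M ^ k * (k ! : ℝ) ^ s) := by
          gcongr
          exact h.abs_iteratedDeriv_le k
      _ = A * (|a| ^ k * M ^ k) * (k ! : ℝ) ^ s := by ring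

theorem contDiffAt_iteratedDeriv (k : ℕ) {f : ℝ → ℝ} {x : ℝ} (hf : ContDiffAt ℝ (⊤ : ℕ∞) f x) :
    ContDiffAt ℝ (⊤ : ℕ∞) (iteratedDeriv k f) x := by
  induction k generalizing f with
  | zero => simpa using hf
  | succ k ih =>
    rw [iteratedDeriv_succ']
    exact ih ((hf.fderiv_right (m := (⊤ : ℕ∞)) (by simp)).clm_apply contDiffAt_const)

/-! ### Gevrey estimates from holomorphic extensions -/

theorem iteratedDeriv_re_ofReal (k : ℕ) {F : ℂ → ℂ} {x : ℝ} (hF : AnalyticAt ℂ F x) :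
    iteratedDeriv k (fun t : ℝ => (F t).re) x = (iteratedDeriv k F x).re := by
  induction k generalizing F with
  | zero => simp
  | succ k ih =>
    rw [iteratedDeriv_succ', iteratedDeriv_succ', ← ih hF.deriv]
    apply Filter.EventuallyEq.iteratedDeriv_eq
    filter_upwards [Complex.continuous_ofReal.continuousAt.eventually hF.eventually_analyticAt]
      with t ht using ht.differentiableAt.hasDerivAt.real_of_complex.deriv

theorem gevreyAt_one_of_holomorphic {F : ℂ → ℂ} {f : ℝ → ℝ} {x r B : ℝ} (hr : 0 < r)
    (hF : ∀ z ∈ Metric.closedBall (x : ℂ) r, DifferentiableAt ℂ F z)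
    (hB : ∀ z ∈ Metric.closedBall (x : ℂ) r, ‖F z‖ ≤ B) (hf : ∀ᶠ t in 𝓝 x, f t = (F t).re) :
    GevreyAt 1 B r⁻¹ f x := by
  have hd : DifferentiableOn ℂ F (Metric.closedBall (x : ℂ) r) :=
    fun z hz => (hF z hz).differentiableWithinAt
  have han : AnalyticAt ℂ F x := hd.analyticAt (Metric.closedBall_mem_nhds _ hr)
  refine GevreyAt.congr_of_eventuallyEq ⟨han.re_ofReal.contDiffAt, fun k => ?_⟩ hf
  rw [iteratedDeriv_re_ofReal k han]
  calc |(iteratedDeriv k F x).re| ≤ ‖iteratedDeriv k F x‖ := Complex.abs_re_le_norm _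
    _ ≤ k ! * B / r ^ k :=
        Complex.norm_iteratedDeriv_le_of_forall_mem_sphere_norm_le k hr
          (hd.diffContOnCl_ball subset_rfl) fun z hz => hB z (Metric.sphere_subset_closedBall hz)
    _ = B * r⁻¹ ^ k * (k ! : ℝ) ^ (1 : ℝ) := by rw [Real.rpow_one, inv_pow]; ring

/-! ### Gluing a flat function with zero -/

theorem hasDerivAt_zero_of_isBigO_sq {g : ℝ → ℝ} (h0 : ∀ x ≤ 0, g x = 0)
    (hO : g =O[𝓝[>] 0] fun x => x ^ 2) {x : ℝ} (hx : x ≤ 0) : HasDerivAt g 0 x := by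
  rcases hx.lt_or_eq with hx | rfl
  · refine (hasDerivAt_const x (0 : ℝ)).congr_of_eventuallyEq ?_
    filter_upwards [Iio_mem_nhds hx] with y hy using h0 y hy.le
  · have hleft : g =O[𝓝[≤] 0] fun x => x ^ 2 :=
      Asymptotics.IsBigO.congr' (Asymptotics.isBigO_zero _ _)
        (eventually_mem_nhdsWithin.mono fun y hy => (h0 y hy).symm) EventuallyEq.rfl
    have hfull : g =O[𝓝 0] fun x => x ^ 2 := by
      rw [← nhdsLE_sup_nhdsGT]
      exact hleft.sup hO
    have hsq : (fun x : ℝ => x ^ 2) =o[𝓝 0] fun x => x := by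
      simpa using Asymptotics.isLittleO_pow_pow (𝕜 := ℝ) one_lt_two
    simpa [hasDerivAt_iff_isLittleO, h0 0 le_rfl] using hfull.trans_isLittleO hsq

theorem iteratedDeriv_eq_zero_of_flat {h : ℝ → ℝ} (h0 : ∀ x ≤ 0, h x = 0)
    (hO : ∀ k : ℕ, iteratedDeriv k h =O[𝓝[>] 0] fun x => x ^ 2) (k : ℕ) {x : ℝ} (hx : x ≤ 0) :
    iteratedDeriv k h x = 0 := by
  induction k generalizing x with
  | zero => simpa using h0 x hx
  | succ k ih =>
    rw [iteratedDeriv_succ]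
    exact (hasDerivAt_zero_of_isBigO_sq (fun y hy => ih hy) (hO k) hx).deriv

theorem contDiffAt_of_flat {h : ℝ → ℝ} {b : ℝ} (h0 : ∀ x ≤ 0, h x = 0)
    (hs : ∀ x ∈ Ioo 0 b, ContDiffAt ℝ (⊤ : ℕ∞) h x)
    (hO : ∀ k : ℕ, iteratedDeriv k h =O[𝓝[>] 0] fun x => x ^ 2) {x : ℝ} (hx : x < b) :
    ContDiffAt ℝ (⊤ : ℕ∞) h x := by
  refine ContDiffOn.contDiffAt (s := Iio b) ?_ (Iio_mem_nhds hx)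
  refine contDiffOn_of_differentiableOn_deriv fun m _ y hy => ?_
  have hEq : EqOn (iteratedDerivWithin m h (Iio b)) (iteratedDeriv m h) (Iio b) :=
    iteratedDerivWithin_of_isOpen isOpen_Iio
  refine DifferentiableWithinAt.congr (DifferentiableAt.differentiableWithinAt ?_) hEq (hEq hy)
  rcases le_or_gt y 0 with hy0 | hy0
  · exact (hasDerivAt_zero_of_isBigO_sq (fun z hz => iteratedDeriv_eq_zero_of_flat h0 hO m hz)
      (hO m) hy0).differentiableAt
  · exact (contDiffAt_iteratedDeriv m (hs y ⟨hy0, hy⟩)).differentiableAt (by simp)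

/-! ### Decay at the origin -/

theorem exp_neg_rpow_le {κ c x : ℝ} (hκ : 0 < κ) (hc : 0 < c) (hx : 0 < x) (j : ℕ) :
    Real.exp (-(c * x ^ (-κ))) ≤ x ^ j * (((κ * c) ^ (-κ⁻¹)) ^ j * (j ! : ℝ) ^ κ⁻¹) := by
  have hbase : 0 ≤ κ * c := by positivity
  have hexp : ((κ * c * x ^ (-κ)) ^ j / j !) ^ κ⁻¹ ≤ Real.exp (c * x ^ (-κ)) :=
    calc ((κ * c * x ^ (-κ)) ^ j / j !) ^ κ⁻¹
        ≤ Real.exp (κ * c * x ^ (-κ)) ^ κ⁻¹ := by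
          gcongr
          exact Real.pow_div_factorial_le_exp _ (by positivity) j
      _ = Real.exp (c * x ^ (-κ)) := by rw [← Real.exp_mul]; field_simp
  have hroot : (x ^ (-κ)) ^ κ⁻¹ = x⁻¹ := by
    rw [← Real.rpow_mul hx.le, neg_mul, mul_inv_cancel₀ hκ.ne', Real.rpow_neg_one]
  rw [Real.div_rpow (by positivity) (by positivity), ← Real.rpow_pow_comm (by positivity),
    Real.mul_rpow hbase (by positivity), hroot] at hexp
  rw [Real.exp_neg, Real.rpow_neg hbase]
  refine (inv_anti₀ (by positivity) hexp).trans_eq ?_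
  rw [inv_div, mul_pow, inv_pow, inv_pow]
  field_simp

/- Cauchy's estimate on a disc of radius `r x` costs a factor `x ^ (-k)`, and `exp (-c x ^ (-κ))`
pays for it at the price of `k ! ^ κ⁻¹`. -/
theorem abs_iteratedDeriv_le_of_exp_decay {h : ℝ → ℝ} {κ c r B x : ℝ} (hκ : 0 < κ) (hc : 0 < c)
    (hr : 0 < r) (hB : 0 ≤ B) (hx : 0 < x)
    (hh : GevreyAt 1 (B * Real.exp (-(c * x ^ (-κ)))) (r * x)⁻¹ h x) (k j : ℕ) :
    |iteratedDeriv k h x| ≤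
      x ^ j * (B * r⁻¹ ^ k * ((κ * c) ^ (-κ⁻¹)) ^ (k + j) * (k ! : ℝ) * ((k + j)! : ℝ) ^ κ⁻¹) :=
  calc |iteratedDeriv k h x|
      ≤ B * Real.exp (-(c * x ^ (-κ))) * (r * x)⁻¹ ^ k * (k ! : ℝ) ^ (1 : ℝ) :=
        hh.abs_iteratedDeriv_le k
    _ ≤ B * (x ^ (k + j) * (((κ * c) ^ (-κ⁻¹)) ^ (k + j) * ((k + j)! : ℝ) ^ κ⁻¹)) *
          (r * x)⁻¹ ^ k * (k ! : ℝ) ^ (1 : ℝ) := by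
        gcongr
        exact exp_neg_rpow_le hκ hc hx (k + j)
    _ = _ := by
        rw [Real.rpow_one, pow_add x, mul_inv, mul_pow, inv_pow x]
        field_simp

theorem gevreyAt_of_exp_decay {h : ℝ → ℝ} {κ c r B b x : ℝ} (hκ : 0 < κ) (hc : 0 < c) (hr : 0 < r)
    (hB : 0 ≤ B) (hb : 0 < b) (h0 : ∀ x ≤ 0, h x = 0)
    (hh : ∀ x ∈ Ioc 0 b, GevreyAt 1 (B * Real.exp (-(c * x ^ (-κ)))) (r * x)⁻¹ h x)
    (hx : x ≤ b) : GevreyAt (1 + κ⁻¹) B (r⁻¹ * (κ * c) ^ (-κ⁻¹)) h x := by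
  have hO (k : ℕ) : iteratedDeriv k h =O[𝓝[>] 0] fun x => x ^ 2 := by
    refine Asymptotics.IsBigO.of_bound
      (B * r⁻¹ ^ k * ((κ * c) ^ (-κ⁻¹)) ^ (k + 2) * (k ! : ℝ) * ((k + 2)! : ℝ) ^ κ⁻¹) ?_
    filter_upwards [Ioc_mem_nhdsGT hb] with y hy
    rw [Real.norm_eq_abs, Real.norm_of_nonneg (sq_nonneg y), mul_comm]
    exact abs_iteratedDeriv_le_of_exp_decay hκ hc hr hB hy.1 (hh y hy) k 2
  refine ⟨?_, fun k => ?_⟩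
  · rcases hx.lt_or_eq with hx | rfl
    · exact contDiffAt_of_flat h0 (fun y hy => (hh y (Ioo_subset_Ioc_self hy)).contDiffAt) hO hx
    · exact (hh x ⟨hb, le_rfl⟩).contDiffAt
  · rcases le_or_gt x 0 with hx0 | hx0
    · rw [iteratedDeriv_eq_zero_of_flat h0 hO k hx0, abs_zero]
      positivity
    · refine (abs_iteratedDeriv_le_of_exp_decay hκ hc hr hB hx0 (hh x ⟨hx0, hx⟩) k 0).trans_eq ?_
      rw [add_zero, Real.rpow_add (by positivity), Real.rpow_one]
      ring

/-! ### The Gevrey step function -/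

theorem half_exp_re_le_norm_one_add_exp {w : ℂ} (h : |w.im| ≤ Real.pi / 2 ∨ 1 ≤ w.re) :
    Real.exp w.re / 2 ≤ ‖1 + Complex.exp w‖ := by
  rcases h with him | hre
  · have hcos : 0 ≤ (Complex.exp w).re := by
      rw [Complex.exp_re]
      exact mul_nonneg (Real.exp_pos _).le (Real.cos_nonneg_of_mem_Icc (abs_le.1 him))
    have hnorm : ‖Complex.exp w‖ ≤ ‖1 + Complex.exp w‖ := by
      rw [← sq_le_sq₀ (norm_nonneg _) (norm_nonneg _), Complex.sq_norm, Complex.sq_norm,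
        Complex.normSq_apply, Complex.normSq_apply]
      simp only [Complex.add_re, Complex.one_re, Complex.add_im, Complex.one_im]
      nlinarith
    rw [Complex.norm_exp] at hnorm
    linarith [Real.exp_pos w.re]
  · have hnorm : ‖Complex.exp w‖ - ‖(1 : ℂ)‖ ≤ ‖1 + Complex.exp w‖ := by
      rw [add_comm]
      exact norm_sub_le_norm_add _ _
    rw [Complex.norm_exp, norm_one] at hnorm
    linarith [Real.add_one_le_exp w.re]

/- Either `η (P + Q) ≤ π / 2`, so that `w` is close to the real axis, or `P` is large, and then so
is the real part of `w`. -/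
theorem exp_le_norm_one_add_exp_of_near {w : ℂ} {P Q q η : ℝ} (hP : 0 ≤ P) (hQ : 0 ≤ Q)
    (hQq : Q ≤ q) (hη : 0 < η) (hη₂ : η ≤ 1 / 2) (hηq : η * (1 + 5 / 2 * q) ≤ Real.pi / 4)
    (hw : ‖w - ((P - Q : ℝ) : ℂ)‖ ≤ η * (P + Q)) :
    Real.exp (1 / 2 * P - 2 * q) / 2 ≤ ‖1 + Complex.exp w‖ := by
  have him : |w.im| ≤ η * (P + Q) := by
    simpa using (Complex.abs_im_le_norm _).trans hw
  have hre : 1 / 2 * P - 2 * q ≤ w.re := by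
    have := (abs_le.1 ((Complex.abs_re_le_norm _).trans hw)).1
    simp only [Complex.sub_re, Complex.ofReal_re] at this
    nlinarith
  have hlarge : |w.im| ≤ Real.pi / 2 ∨ 1 ≤ w.re := by
    refine or_iff_not_imp_left.2 fun h => ?_
    have : 2 * (1 + 5 / 2 * q) < P + Q := by
      refine lt_of_mul_lt_mul_left ?_ hη.le
      linarith [not_le.1 h]
    linarith
  calc Real.exp (1 / 2 * P - 2 * q) / 2 ≤ Real.exp w.re / 2 := by gcongr
    _ ≤ ‖1 + Complex.exp w‖ := half_exp_re_le_norm_one_add_exp hlarge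

theorem ofReal_mul_cpow {a p : ℝ} {ζ : ℂ} (ha : 0 < a) (hζ : ζ ≠ 0) :
    (a * ζ) ^ (p : ℂ) = (a ^ p : ℝ) * ζ ^ (p : ℂ) := by
  have ha' : (a : ℂ) ≠ 0 := mod_cast ha.ne'
  rw [Complex.ofReal_cpow ha.le, Complex.cpow_def_of_ne_zero (mul_ne_zero ha' hζ),
    Complex.log_ofReal_mul ha hζ, add_mul, Complex.exp_add, Complex.ofReal_log ha.le,
    ← Complex.cpow_def_of_ne_zero ha', ← Complex.cpow_def_of_ne_zero hζ]

theorem exists_norm_cpow_sub_le (p : ℝ) {η : ℝ} (hη : 0 < η) :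
    ∃ r ∈ Ioo (0 : ℝ) 1, ∀ a : ℝ, 0 < a → ∀ z : ℂ, ‖z - a‖ ≤ r * a →
      z ∈ Complex.slitPlane ∧ ‖z ^ (p : ℂ) - (a ^ p : ℝ)‖ ≤ η * a ^ p := by
  have hcont : ContinuousAt (fun ζ : ℂ => ζ ^ (p : ℂ)) 1 :=
    continuousAt_cpow_const Complex.one_mem_slitPlane
  obtain ⟨δ, hδ, hball⟩ := Metric.continuousAt_iff.1 hcont η hη
  refine ⟨min (δ / 2) (1 / 2), ⟨by positivity, by linarith [min_le_right (δ / 2) (1 / 2)]⟩,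
    fun a ha z hz => ?_⟩
  obtain ⟨ζ, rfl⟩ : ∃ ζ : ℂ, z = a * ζ := ⟨z / a, (mul_div_cancel₀ z (by simp [ha.ne'])).symm⟩
  have hζ : ‖ζ - 1‖ ≤ min (δ / 2) (1 / 2) := by
    rw [← mul_sub_one, norm_mul, Complex.norm_real, Real.norm_of_nonneg ha.le, mul_comm] at hz
    exact le_of_mul_le_mul_right hz ha
  have hζslit : ζ ∈ Complex.slitPlane := by
    left
    have := (abs_le.1 ((Complex.abs_re_le_norm _).trans (hζ.trans (min_le_right _ _)))).1
    rw [Complex.sub_re, Complex.one_re] at this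
    linarith
  have hζpow : ‖ζ ^ (p : ℂ) - 1‖ ≤ η := by
    have := hball (x := ζ) (by
      rw [dist_eq_norm]
      linarith [min_le_left (δ / 2) (1 / 2)])
    simpa [dist_eq_norm] using this.le
  refine ⟨?_, ?_⟩
  · rw [Complex.mem_slitPlane_iff] at hζslit ⊢
    simpa [ha, ha.ne'] using hζslit
  · rw [ofReal_mul_cpow ha (Complex.slitPlane_ne_zero hζslit), ← mul_sub_one, norm_mul,
      Complex.norm_real, Real.norm_of_nonneg (by positivity), mul_comm]
    gcongr

/-- The exponent in the holomorphic extension of `1 - φ_s = 1 / (1 + exp (t^{-κ} - (1-t)^{-κ}))`,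
`κ = (s - 1)⁻¹`, from `(0,1)` to a complex neighbourhood. -/
def stepExponent (κ : ℝ) (z : ℂ) : ℂ := z ^ ((-κ : ℝ) : ℂ) - (1 - z) ^ ((-κ : ℝ) : ℂ)

theorem one_sub_step_eq {s t : ℝ} (ht : t ∈ Ioo (0 : ℝ) 1) :
    1 - step s t = (1 / (1 + Complex.exp (stepExponent (s - 1)⁻¹ t))).re := by
  have hexp : stepExponent (s - 1)⁻¹ t =
      ((t ^ (-(s - 1)⁻¹) - (1 - t) ^ (-(s - 1)⁻¹) : ℝ) : ℂ) := by
    rw [stepExponent, Complex.ofReal_sub, Complex.ofReal_cpow ht.1.le,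
      Complex.ofReal_cpow (sub_nonneg.2 ht.2.le), Complex.ofReal_sub, Complex.ofReal_one]
  rw [hexp, ← Complex.ofReal_exp, ← Complex.ofReal_one, ← Complex.ofReal_add, ← Complex.ofReal_div,
    Complex.ofReal_re, step, if_neg (not_le.2 ht.1), if_neg (not_le.2 ht.2), Real.exp_sub,
    Real.exp_neg, Real.exp_neg]
  field_simp
  ring

theorem exists_stepExponent_near {κ η : ℝ} (hη : 0 < η) :
    ∃ r ∈ Ioo (0 : ℝ) 1, ∀ t ∈ Ioc (0 : ℝ) (1 / 2), ∀ z : ℂ, ‖z - t‖ ≤ r * t →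
      DifferentiableAt ℂ (stepExponent κ) z ∧
      ‖stepExponent κ z - ((t ^ (-κ) - (1 - t) ^ (-κ) : ℝ) : ℂ)‖ ≤
        η * (t ^ (-κ) + (1 - t) ^ (-κ)) := by
  obtain ⟨r, hr, hpow⟩ := exists_norm_cpow_sub_le (-κ) hη
  refine ⟨r, hr, fun t ht z hz => ?_⟩
  have hz' : ‖1 - z - ((1 - t : ℝ) : ℂ)‖ ≤ r * (1 - t) := by
    rw [Complex.ofReal_sub, Complex.ofReal_one, sub_sub_sub_cancel_left, norm_sub_rev]
    exact hz.trans (mul_le_mul_of_nonneg_left (by linarith [ht.2]) hr.1.le)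
  obtain ⟨hslit, hle⟩ := hpow t ht.1 z hz
  obtain ⟨hslit', hle'⟩ := hpow (1 - t) (by linarith [ht.2]) (1 - z) hz'
  refine ⟨?_, ?_⟩
  · exact (differentiableAt_id.cpow_const hslit).sub
      ((differentiableAt_id.const_sub 1).cpow_const hslit')
  · rw [stepExponent, Complex.ofReal_sub, sub_sub_sub_comm, mul_add]
    exact (norm_sub_le _ _).trans (add_le_add hle hle')

theorem exists_norm_one_add_exp_stepExponent_ge {κ : ℝ} (hκ : 0 ≤ κ) :
    ∃ r ∈ Ioo (0 : ℝ) 1, ∃ B : ℝ, 0 < B ∧ ∀ t ∈ Ioc (0 : ℝ) (1 / 2), ∀ z : ℂ, ‖z - t‖ ≤ r * t →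
      DifferentiableAt ℂ (stepExponent κ) z ∧
        B * Real.exp (1 / 2 * t ^ (-κ)) ≤ ‖1 + Complex.exp (stepExponent κ z)‖ := by
  set q : ℝ := (2 : ℝ) ^ κ
  have : 0 < q := by positivity
  set η : ℝ := min (1 / 2) (Real.pi / 4 / (1 + 5 / 2 * q))
  have hη : 0 < η := by have := Real.pi_pos; positivity
  have hηq : η * (1 + 5 / 2 * q) ≤ Real.pi / 4 := by
    rw [← le_div_iff₀ (by positivity)]
    exact min_le_right _ _
  obtain ⟨r, hr, hnear⟩ := exists_stepExponent_near (κ := κ) hη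
  refine ⟨r, hr, Real.exp (-(2 * q)) / 2, by positivity, fun t ht z hz => ?_⟩
  obtain ⟨hdiff, hle⟩ := hnear t ht z hz
  have ht' : 0 < 1 - t := by linarith [ht.2]
  have hQ : (1 - t) ^ (-κ) ≤ q :=
    calc (1 - t) ^ (-κ) ≤ (1 / 2 : ℝ) ^ (-κ) :=
          Real.rpow_le_rpow_of_nonpos (by norm_num) (by linarith [ht.2]) (by linarith)
      _ = q := by rw [Real.rpow_neg (by norm_num), ← Real.inv_rpow (by norm_num), one_div, inv_inv]
  refine ⟨hdiff, le_trans (le_of_eq ?_) (exp_le_norm_one_add_exp_of_near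
    (Real.rpow_nonneg ht.1.le _) (Real.rpow_nonneg ht'.le _) hQ hη (min_le_left _ _) hηq hle)⟩
  rw [sub_eq_add_neg, Real.exp_add]
  ring

theorem step_of_nonpos {s x : ℝ} (hx : x ≤ 0) : step s x = 1 := if_pos hx

theorem step_of_one_le {s x : ℝ} (hx : 1 ≤ x) : step s x = 0 := by
  rw [step, if_neg (by linarith), if_pos hx]

theorem step_one_sub (s x : ℝ) : step s (1 - x) = 1 - step s x := by
  rcases le_or_gt x 0 with hx | hx
  · rw [step_of_nonpos hx, step_of_one_le (by linarith), sub_self]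
  rcases le_or_gt 1 x with hx1 | hx1
  · rw [step_of_one_le hx1, step_of_nonpos (by linarith), sub_zero]
  rw [step, step, if_neg (by linarith), if_neg (by linarith), if_neg (by linarith),
    if_neg (by linarith), sub_sub_cancel]
  field_simp
  ring

theorem exists_gevreyAt_one_sub_step {s : ℝ} (hs : 1 < s) :
    ∃ A M : ℝ, 0 < A ∧ 0 < M ∧ ∀ x ≤ 1 / 2, GevreyAt s A M (fun x => 1 - step s x) x := by
  set κ : ℝ := (s - 1)⁻¹ with hκ_def
  have hκ : 0 < κ := inv_pos.2 (sub_pos.2 hs)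
  have hs_eq : 1 + κ⁻¹ = s := by rw [hκ_def, inv_inv]; ring
  obtain ⟨r, hr, B, hB, hlow⟩ := exists_norm_one_add_exp_stepExponent_ge hκ.le
  have hr0 : 0 < r := hr.1
  refine ⟨B⁻¹, r⁻¹ * (κ * (1 / 2)) ^ (-κ⁻¹), by positivity, by positivity, fun x hx => ?_⟩
  rw [← hs_eq]
  refine gevreyAt_of_exp_decay hκ (by norm_num) hr0 (by positivity) (b := 1 / 2) (by norm_num)
    (fun y hy => by rw [hs_eq, step_of_nonpos hy, sub_self]) (fun y hy => ?_) hx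
  have hlow' : ∀ z ∈ Metric.closedBall (y : ℂ) (r * y), _ := fun z hz =>
    hlow y hy z (by simpa [dist_eq_norm] using hz)
  refine gevreyAt_one_of_holomorphic (mul_pos hr0 hy.1)
    (F := fun z => 1 / (1 + Complex.exp (stepExponent κ z))) (fun z hz => ?_) (fun z hz => ?_) ?_
  · have hne : 1 + Complex.exp (stepExponent κ z) ≠ 0 :=
      norm_pos_iff.1 (lt_of_lt_of_le (by positivity) (hlow' z hz).2)
    exact (differentiableAt_const _).div ((hlow' z hz).1.cexp.const_add 1) hne
  · rw [norm_div, norm_one, Real.exp_neg, ← mul_inv, one_div]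
    exact inv_anti₀ (by positivity) (hlow' z hz).2
  · filter_upwards [Ioo_mem_nhds hy.1 (hy.2.trans_lt one_half_lt_one)] with t ht
    rw [hs_eq, one_sub_step_eq ht]

theorem exists_gevreyAt_step {s : ℝ} (hs : 1 < s) :
    ∃ A M : ℝ, 0 < A ∧ 0 < M ∧ ∀ x, GevreyAt s A M (step s) x := by
  obtain ⟨A, M, hA, hM, h⟩ := exists_gevreyAt_one_sub_step hs
  refine ⟨1 + A, M, by positivity, hM, fun x => ?_⟩
  rcases le_or_gt x (1 / 2) with hx | hx
  · simpa using (h x hx).const_sub 1 hM.le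
  · have hrefl : GevreyAt s A M (fun x => 1 - step s x) (-1 * x + 1) := h _ (by linarith)
    have := hrefl.comp_affine
    rw [abs_neg, abs_one, one_mul] at this
    refine (this.mono le_rfl (by linarith) hM.le le_rfl).congr_of_eventuallyEq
      (Eventually.of_forall fun y => ?_)
    simp only [neg_one_mul, neg_add_eq_sub, step_one_sub, sub_sub_cancel]

/-! ### Cut-off Taylor series -/

/-- Cauchy's estimate for the Taylor coefficients `d` of a function bounded by `A` on a disc of
radius `ρ`. -/
def CauchyEstimate (A ρ : ℝ) (d : ℕ → ℝ) : Prop := ∀ k : ℕ, |d k| ≤ A * (k ! / ρ ^ k)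

/-- The sum of the Taylor series at the origin with derivatives `d`. -/
def taylorSum (d : ℕ → ℝ) (x : ℝ) : ℝ := ∑' k : ℕ, d k * x ^ k / (k ! : ℝ)

/-- The holomorphic extension of `taylorSum d`. -/
def complexTaylorSum (d : ℕ → ℝ) (z : ℂ) : ℂ := ∑' k : ℕ, (d k : ℂ) * z ^ k / (k ! : ℂ)

theorem complexTaylorSum_ofReal (d : ℕ → ℝ) (x : ℝ) : complexTaylorSum d x = taylorSum d x := by
  rw [complexTaylorSum, taylorSum, Complex.ofReal_tsum]
  exact tsum_congr fun k => by push_cast; rfl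

namespace CauchyEstimate

variable {A B ρ ρ' x : ℝ} {d e : ℕ → ℝ}

theorem nonneg (h : CauchyEstimate A ρ d) : 0 ≤ A := by
  simpa using (abs_nonneg _).trans (h 0)

theorem mono (h : CauchyEstimate A ρ d) (hAB : A ≤ B) (hρ' : 0 < ρ') (hρ : ρ' ≤ ρ) :
    CauchyEstimate B ρ' d := fun k => by
  have hB : 0 ≤ B := h.nonneg.trans hAB
  have hρ0 : 0 < ρ := hρ'.trans_le hρ
  refine (h k).trans ?_
  gcongr

theorem sub (hd : CauchyEstimate A ρ d) (he : CauchyEstimate B ρ e) :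
    CauchyEstimate (A + B) ρ fun k => d k - e k := fun k => by
  rw [add_mul]
  exact (abs_sub _ _).trans (add_le_add (hd k) (he k))

theorem norm_term_le (hd : CauchyEstimate A ρ d) {z : ℂ} {σ : ℝ} (hρ : 0 < ρ) (hz : ‖z‖ ≤ σ)
    (k : ℕ) : ‖(d k : ℂ) * z ^ k / (k ! : ℂ)‖ ≤ A * (σ / ρ) ^ k := by
  have hA := hd.nonneg
  rw [norm_div, norm_mul, norm_pow, Complex.norm_real, Complex.norm_natCast, Real.norm_eq_abs]
  calc |d k| * ‖z‖ ^ k / k ! ≤ A * (k ! / ρ ^ k) * σ ^ k / k ! := by gcongr; exact hd k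
    _ = A * (σ / ρ) ^ k := by rw [div_pow]; field_simp

theorem hasSum_majorant {σ : ℝ} (hρ : 0 < ρ) (hσ : 0 ≤ σ) (hσρ : σ < ρ) (A : ℝ) :
    HasSum (fun k : ℕ => A * (σ / ρ) ^ k) (A * (1 - σ / ρ)⁻¹) :=
  (hasSum_geometric_of_lt_one (by positivity) ((div_lt_one hρ).2 hσρ)).mul_left A

theorem summable (hd : CauchyEstimate A ρ d) (hρ : 0 < ρ) (hx : |x| < ρ) :
    Summable fun k : ℕ => d k * x ^ k / (k ! : ℝ) := by
  refine Summable.of_norm_bounded (hasSum_majorant hρ (abs_nonneg x) hx A).summable fun k => ?_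
  simpa using hd.norm_term_le (z := x) hρ (Complex.norm_real x).le k

theorem norm_complexTaylorSum_le (hd : CauchyEstimate A ρ d) {z : ℂ} {σ : ℝ} (hρ : 0 < ρ)
    (hz : ‖z‖ ≤ σ) (hσ : σ < ρ) : ‖complexTaylorSum d z‖ ≤ A * (1 - σ / ρ)⁻¹ :=
  tsum_of_norm_bounded (hasSum_majorant hρ ((norm_nonneg z).trans hz) hσ A)
    (hd.norm_term_le hρ hz)

theorem differentiableAt_complexTaylorSum (hd : CauchyEstimate A ρ d) {z : ℂ} (hρ : 0 < ρ)
    (hz : ‖z‖ < ρ) : DifferentiableAt ℂ (complexTaylorSum d) z := by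
  obtain ⟨σ, hzσ, hσρ⟩ := exists_between hz
  have hdiff : DifferentiableOn ℂ (complexTaylorSum d) (Metric.ball 0 σ) :=
    Complex.differentiableOn_tsum_of_summable_norm
      (hasSum_majorant hρ ((norm_nonneg z).trans hzσ.le) hσρ A).summable
      (fun k => by fun_prop) Metric.isOpen_ball
      fun k w hw => hd.norm_term_le hρ (mem_ball_zero_iff.1 hw).le k
  exact hdiff.differentiableAt (Metric.isOpen_ball.mem_nhds (mem_ball_zero_iff.2 hzσ))

theorem gevreyAt_taylorSum (hd : CauchyEstimate A ρ d) {r : ℝ} (hr : 0 < r) (hx : |x| + r < ρ) :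
    GevreyAt 1 (A * (1 - (|x| + r) / ρ)⁻¹) r⁻¹ (taylorSum d) x := by
  have hρ : 0 < ρ := by linarith [abs_nonneg x]
  have hball : ∀ z ∈ Metric.closedBall (x : ℂ) r, ‖z‖ ≤ |x| + r := fun z hz => by
    simpa [add_comm] using norm_le_of_mem_closedBall hz
  refine gevreyAt_one_of_holomorphic (F := complexTaylorSum d) hr
    (fun z hz => hd.differentiableAt_complexTaylorSum hρ ((hball z hz).trans_lt hx))
    (fun z hz => hd.norm_complexTaylorSum_le hρ (hball z hz) hx) (Eventually.of_forall fun t => ?_)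
  rw [complexTaylorSum_ofReal, Complex.ofReal_re]

end CauchyEstimate

/-- The Taylor series at `τ` with derivatives `d`, cut off by the step function. The flat output and
its truncations are of this form. -/
def cutoffSeries (s τ R' : ℝ) (d : ℕ → ℝ) (t : ℝ) : ℝ :=
  step s ((t - τ) / R') * taylorSum d (t - τ)

theorem cutoffSeries_of_le {s τ R' t : ℝ} (d : ℕ → ℝ) (hR' : 0 < R') (ht : τ + R' ≤ t) :
    cutoffSeries s τ R' d t = 0 := by
  rw [cutoffSeries, step_of_one_le ((one_le_div hR').2 (by linarith)), zero_mul]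

theorem exists_gevreyAt_cutoffSeries {s R' ρ : ℝ} (hs : 1 < s) (hR' : 0 < R') (hρ : R' < ρ) :
    ∃ C M : ℝ, 0 < C ∧ 0 < M ∧ ∀ (τ A : ℝ) (d : ℕ → ℝ), CauchyEstimate A ρ d → ∀ t, τ ≤ t →
      GevreyAt s (A * C) M (cutoffSeries s τ R' d) t := by
  obtain ⟨A₁, M₁, hA₁, hM₁, hstep⟩ := exists_gevreyAt_step hs
  obtain ⟨σ, hR'σ, hσρ⟩ := exists_between hρ
  have hr : 0 < σ - R' := sub_pos.2 hR'σ
  have hq : 0 < 1 - σ / ρ := sub_pos.2 ((div_lt_one (by linarith)).2 hσρ)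
  refine ⟨A₁ * (1 - σ / ρ)⁻¹, |R'⁻¹| * M₁ + (σ - R')⁻¹, by positivity, by positivity,
    fun τ A d hd t ht => ?_⟩
  have hA := hd.nonneg
  rcases le_or_gt t (τ + R') with ht' | ht'
  · have hseries : GevreyAt 1 (A * (1 - σ / ρ)⁻¹) (σ - R')⁻¹ (taylorSum d) (1 * t + -τ) := by
      have habs : |1 * t + -τ| ≤ R' := abs_le.2 ⟨by linarith, by linarith⟩
      refine (hd.gevreyAt_taylorSum hr (by linarith)).mono le_rfl ?_ (by positivity) le_rfl
      have : |1 * t + -τ| + (σ - R') ≤ σ := by linarith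
      have : 0 < ρ := hR'.trans hρ
      gcongr
    have hprod := ((hstep (R'⁻¹ * t + -(τ / R'))).comp_affine.mul (hseries.comp_affine.mono hs.le
      le_rfl (by positivity) le_rfl) (by linarith) (by positivity) (by positivity))
    refine GevreyAt.congr_of_eventuallyEq (hprod.mono le_rfl (by linarith) (by positivity)
      (by rw [abs_one, one_mul])) (Eventually.of_forall fun u => ?_)
    rw [cutoffSeries]
    congr 2 <;> ring
  · refine GevreyAt.of_eventuallyEq_zero (by positivity) (by positivity) ?_
    filter_upwards [Ioi_mem_nhds ht'] with u hu using cutoffSeries_of_le d hR' (mem_Ioi.1 hu).le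

theorem cutoffSeries_sub {s τ R' ρ A B t : ℝ} {d e : ℕ → ℝ} (hR' : 0 < R') (hρ : R' < ρ)
    (hd : CauchyEstimate A ρ d) (he : CauchyEstimate B ρ e) (ht : τ - ρ < t) :
    cutoffSeries s τ R' (fun k => d k - e k) t =
      cutoffSeries s τ R' d t - cutoffSeries s τ R' e t := by
  rcases le_or_gt (τ + R') t with ht' | ht'
  · simp only [cutoffSeries_of_le _ hR' ht', sub_zero]
  · have hx : |t - τ| < ρ := abs_lt.2 ⟨by linarith, by linarith⟩
    have hρ0 : 0 < ρ := hR'.trans hρ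
    rw [cutoffSeries, cutoffSeries, cutoffSeries, ← mul_sub, taylorSum, taylorSum, taylorSum,
      ← (hd.summable hρ0 hx).tsum_sub (he.summable hρ0 hx)]
    exact congrArg _ (tsum_congr fun k => by ring)

/-! ### The control series -/

theorem pow_self_le_factorial_sq (n : ℕ) : n ^ n ≤ n ! ^ 2 := by
  have hpair : n ! ^ 2 = ∏ j ∈ Finset.range n, (j + 1) * (n - 1 - j + 1) := by
    rw [Finset.prod_mul_distrib, Finset.prod_range_add_one_eq_factorial,
      Finset.prod_range_reflect (fun j => j + 1) n, Finset.prod_range_add_one_eq_factorial, sq]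
  calc n ^ n = ∏ _j ∈ Finset.range n, n := by simp
    _ ≤ ∏ j ∈ Finset.range n, (j + 1) * (n - 1 - j + 1) := by
      refine Finset.prod_le_prod' fun j hj => ?_
      obtain ⟨m, rfl⟩ : ∃ m, n = j + 1 + m := Nat.exists_eq_add_of_le (Finset.mem_range.1 hj)
      rw [show j + 1 + m - 1 - j + 1 = m + 1 by omega]
      nlinarith
    _ = n ! ^ 2 := hpair.symm

theorem inv_factorial_rpow_le {ε : ℝ} (hε : 0 ≤ ε) (n : ℕ) :
    ((n ! : ℝ) ^ ε)⁻¹ ≤ Real.exp (-(ε / 2) * (n * Real.log n)) := by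
  rcases n.eq_zero_or_pos with rfl | hn
  · simp
  have hlog : (n : ℝ) * Real.log n ≤ 2 * Real.log (n ! : ℝ) := by
    have := Real.log_le_log (by positivity)
      (mod_cast pow_self_le_factorial_sq n : (n : ℝ) ^ n ≤ (n ! : ℝ) ^ 2)
    rwa [Real.log_pow, Real.log_pow, Nat.cast_ofNat] at this
  rw [← Real.rpow_neg (by positivity), Real.rpow_def_of_pos (by positivity)]
  exact Real.exp_le_exp.2 (by nlinarith)

theorem summable_pow_div_factorial_rpow {L ε : ℝ} (hL : 0 < L) (hε : 0 < ε) :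
    Summable fun i : ℕ => L ^ i / (i ! : ℝ) ^ ε := by
  refine summable_of_ratio_test_tendsto_lt_one zero_lt_one
    (Eventually.of_forall fun i => by positivity) ?_
  have hratio (i : ℕ) : ‖L ^ (i + 1) / ((i + 1)! : ℝ) ^ ε‖ / ‖L ^ i / (i ! : ℝ) ^ ε‖ =
      L / ((i + 1 : ℕ) : ℝ) ^ ε := by
    rw [Real.norm_of_nonneg (by positivity), Real.norm_of_nonneg (by positivity),
      Nat.factorial_succ, Nat.cast_mul, Real.mul_rpow (by positivity) (by positivity), pow_succ]
    field_simp
  simp only [hratio]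
  exact ((tendsto_rpow_atTop hε).comp (tendsto_natCast_atTop_atTop.comp
    (tendsto_add_atTop_nat 1))).const_div_atTop L

/-- Majorant for the `i`-th term of the control series of a function which is Gevrey of order
`s < 2`: the ratio `(i + 1)! ^ s / (2 * i + 1)!` is of size `2 ^ i * (i + 1)! ^ (s - 2)`, and only
half of the exponent `2 - s` is kept here, the other half giving the decay of the tails. -/
def controlWeight (s M : ℝ) (i : ℕ) : ℝ :=
  (2 * M) ^ (i + 1) / ((i + 1)! : ℝ) ^ ((2 - s) / 2)

theorem controlWeight_pos {s M : ℝ} (hM : 0 < M) (i : ℕ) : 0 < controlWeight s M i := by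
  rw [controlWeight]
  positivity

theorem summable_controlWeight {s M : ℝ} (hs : s < 2) (hM : 0 < M) :
    Summable (controlWeight s M) :=
  (summable_nat_add_iff 1).2 <|
    summable_pow_div_factorial_rpow (L := 2 * M) (ε := (2 - s) / 2) (by positivity) (by linarith)

theorem factorial_succ_sq_le (i : ℕ) : (i + 1)! ^ 2 ≤ 2 ^ (i + 1) * (2 * i + 1)! := by
  have hmul : (i + 1)! * i ! ≤ (2 * i + 1)! := by
    have := Nat.factorial_mul_factorial_dvd_factorial_add (i + 1) i
    rw [show i + 1 + i = 2 * i + 1 by ring] at this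
    exact Nat.le_of_dvd (Nat.factorial_pos _) this
  calc (i + 1)! ^ 2 = (i + 1) * ((i + 1)! * i !) := by
        rw [sq]
        nth_rewrite 2 [Nat.factorial_succ]
        ring
    _ ≤ 2 ^ (i + 1) * (2 * i + 1)! := Nat.mul_le_mul Nat.lt_two_pow_self.le hmul

theorem gevrey_term_le_controlWeight {s M : ℝ} (hs : s < 2) (hM : 0 ≤ M) {I i : ℕ} (hi : I ≤ i) :
    M ^ (i + 1) * ((i + 1)! : ℝ) ^ s / ((2 * i + 1)! : ℝ) ≤
      Real.exp (-((2 - s) / 4) * (I * Real.log I)) * controlWeight s M i := by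
  have hsq : ((i + 1)! : ℝ) ^ 2 ≤ 2 ^ (i + 1) * ((2 * i + 1)! : ℝ) :=
    mod_cast factorial_succ_sq_le i
  have hle : (I ! : ℝ) ≤ ((i + 1)! : ℝ) := mod_cast Nat.factorial_le (hi.trans i.le_succ)
  set F : ℝ := ((i + 1)! : ℝ) with hFdef
  have hF : 0 < F := by positivity
  have hpow : F ^ s = F ^ 2 * ((F ^ ((2 - s) / 2))⁻¹ * (F ^ ((2 - s) / 2))⁻¹) := by
    rw [← Real.rpow_neg hF.le, ← Real.rpow_add hF, ← Real.rpow_two, ← Real.rpow_add hF]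
    ring_nf
  have htail : (F ^ ((2 - s) / 2))⁻¹ ≤ Real.exp (-((2 - s) / 4) * (I * Real.log I)) :=
    calc (F ^ ((2 - s) / 2))⁻¹ ≤ ((I ! : ℝ) ^ ((2 - s) / 2))⁻¹ := by
          have : 0 < 2 - s := sub_pos.2 hs
          gcongr
      _ ≤ Real.exp (-((2 - s) / 2 / 2) * (I * Real.log I)) :=
          inv_factorial_rpow_le (by linarith) I
      _ = Real.exp (-((2 - s) / 4) * (I * Real.log I)) := by ring_nf
  rw [div_le_iff₀ (by positivity), hpow]
  calc M ^ (i + 1) * (F ^ 2 * ((F ^ ((2 - s) / 2))⁻¹ * (F ^ ((2 - s) / 2))⁻¹))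
      ≤ M ^ (i + 1) * (2 ^ (i + 1) * ((2 * i + 1)! : ℝ) *
        (Real.exp (-((2 - s) / 4) * (I * Real.log I)) * (F ^ ((2 - s) / 2))⁻¹)) := by gcongr
    _ = Real.exp (-((2 - s) / 4) * (I * Real.log I)) * controlWeight s M i *
        ((2 * i + 1)! : ℝ) := by
      rw [controlWeight, mul_pow, ← hFdef]
      ring

/-- The `i`-th term of the control series `∑ y^{(i)} / (2i-1)!`, with the index shifted by one as in
`control`. -/
def controlTerm (y : ℝ → ℝ) (i : ℕ) (t : ℝ) : ℝ := iteratedDeriv (i + 1) y t / ((2 * i + 1)! : ℝ)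

theorem controlTerm_sub {y z : ℝ → ℝ} {t : ℝ} (hy : ContDiffAt ℝ (⊤ : ℕ∞) y t)
    (hz : ContDiffAt ℝ (⊤ : ℕ∞) z t) (i : ℕ) :
    controlTerm (fun t => y t - z t) i t = controlTerm y i t - controlTerm z i t := by
  rw [controlTerm, iteratedDeriv_fun_sub (hy.of_le (mod_cast le_top))
    (hz.of_le (mod_cast le_top)), sub_div, controlTerm, controlTerm]

theorem continuousOn_controlTerm {y : ℝ → ℝ} {S : Set ℝ}
    (hy : ∀ t ∈ S, ContDiffAt ℝ (⊤ : ℕ∞) y t) (i : ℕ) : ContinuousOn (controlTerm y i) S :=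
  fun t ht =>
    ((contDiffAt_iteratedDeriv (i + 1) (hy t ht)).continuousAt.div_const _).continuousWithinAt

namespace GevreyAt

variable {s A E M t : ℝ} {y z : ℝ → ℝ}

theorem abs_controlTerm_le_exp_mul (hy : GevreyAt s A M y t) (hs : s < 2) (hM : 0 ≤ M) {I i : ℕ}
    (hi : I ≤ i) : |controlTerm y i t| ≤
      A * Real.exp (-((2 - s) / 4) * (I * Real.log I)) * controlWeight s M i := by
  have hA := hy.nonneg
  rw [controlTerm, abs_div, Nat.abs_cast]
  calc |iteratedDeriv (i + 1) y t| / ((2 * i + 1)! : ℝ)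
      ≤ A * M ^ (i + 1) * ((i + 1)! : ℝ) ^ s / ((2 * i + 1)! : ℝ) := by
        gcongr
        exact hy.abs_iteratedDeriv_le (i + 1)
    _ = A * (M ^ (i + 1) * ((i + 1)! : ℝ) ^ s / ((2 * i + 1)! : ℝ)) := by ring
    _ ≤ A * (Real.exp (-((2 - s) / 4) * (I * Real.log I)) * controlWeight s M i) := by
        gcongr
        exact gevrey_term_le_controlWeight hs hM hi
    _ = _ := by ring

theorem abs_controlTerm_le (hy : GevreyAt s A M y t) (hs : s < 2) (hM : 0 ≤ M) (i : ℕ) :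
    |controlTerm y i t| ≤ A * controlWeight s M i := by
  simpa using hy.abs_controlTerm_le_exp_mul hs hM i.zero_le

theorem summable_controlTerm (hy : GevreyAt s A M y t) (hs : s < 2) (hM : 0 < M) :
    Summable fun i => controlTerm y i t :=
  .of_norm_bounded ((summable_controlWeight hs hM).mul_left A) (hy.abs_controlTerm_le hs hM.le)

theorem abs_sum_controlTerm_le (hy : GevreyAt s A M y t) (hs : s < 2) (hM : 0 < M) (I : ℕ) :
    |∑ i ∈ Finset.range I, controlTerm y i t| ≤ A * ∑' i, controlWeight s M i :=
  calc |∑ i ∈ Finset.range I, controlTerm y i t|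
      ≤ ∑ i ∈ Finset.range I, A * controlWeight s M i :=
        (Finset.abs_sum_le_sum_abs _ _).trans
          (Finset.sum_le_sum fun i _ => hy.abs_controlTerm_le hs hM.le i)
    _ ≤ A * ∑' i, controlWeight s M i := by
        rw [← Finset.mul_sum]
        exact mul_le_mul_of_nonneg_left ((summable_controlWeight hs hM).sum_le_tsum _
          fun i _ => (controlWeight_pos hM i).le) hy.nonneg

theorem abs_tsum_controlTerm_add_le (hy : GevreyAt s A M y t) (hs : s < 2) (hM : 0 < M) (I : ℕ) :
    |∑' i, controlTerm y (i + I) t| ≤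
      A * Real.exp (-((2 - s) / 4) * (I * Real.log I)) * ∑' i, controlWeight s M i := by
  have hA := hy.nonneg
  have hw := summable_controlWeight hs hM
  have hshift : ∑' i, controlWeight s M (i + I) ≤ ∑' i, controlWeight s M i := by
    rw [← hw.sum_add_tsum_nat_add I]
    exact le_add_of_nonneg_left (Finset.sum_nonneg fun i _ => (controlWeight_pos hM i).le)
  refine (tsum_of_norm_bounded (f := fun i => controlTerm y (i + I) t)
    (((summable_nat_add_iff I).2 hw).hasSum.mul_left _) fun i =>
      hy.abs_controlTerm_le_exp_mul hs hM.le (Nat.le_add_left I i)).trans ?_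
  gcongr

theorem abs_tsum_controlTerm_sub_sum_le (hy : GevreyAt s A M y t)
    (hz : ContDiffAt ℝ (⊤ : ℕ∞) z t) (hyz : GevreyAt s E M (fun t => y t - z t) t) (hs : s < 2)
    (hM : 0 < M) (I : ℕ) :
    |(∑' i, controlTerm y i t) - ∑ i ∈ Finset.range I, controlTerm z i t| ≤
      (A * Real.exp (-((2 - s) / 4) * (I * Real.log I)) + E) * ∑' i, controlWeight s M i := by
  have hsplit : (∑' i, controlTerm y i t) - ∑ i ∈ Finset.range I, controlTerm z i t =
      ∑' i, controlTerm y (i + I) t +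
        ∑ i ∈ Finset.range I, controlTerm (fun t => y t - z t) i t := by
    simp only [controlTerm_sub hy.contDiffAt hz, Finset.sum_sub_distrib]
    rw [← (hy.summable_controlTerm hs hM).sum_add_tsum_nat_add I]
    ring
  rw [hsplit, add_mul]
  exact (abs_add_le _ _).trans (add_le_add (hy.abs_tsum_controlTerm_add_le hs hM I)
    (hyz.abs_sum_controlTerm_le hs hM I))

end GevreyAt

/-! ### The flat output and its truncations -/

theorem pow_mul_exp_neg_le {x τ ρ : ℝ} (hx : 0 ≤ x) (hρ : 0 < ρ) (k : ℕ) :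
    x ^ k * Real.exp (-(x * τ)) ≤ k ! / ρ ^ k * Real.exp (-(x * (τ - ρ))) := by
  have h := Real.pow_div_factorial_le_exp (x * ρ) (by positivity) k
  rw [div_le_iff₀ (by positivity), mul_pow] at h
  rw [div_mul_eq_mul_div, le_div_iff₀ (by positivity)]
  calc x ^ k * Real.exp (-(x * τ)) * ρ ^ k = x ^ k * ρ ^ k * Real.exp (-(x * τ)) := by ring
    _ ≤ Real.exp (x * ρ) * k ! * Real.exp (-(x * τ)) := by gcongr
    _ = k ! * Real.exp (-(x * (τ - ρ))) := by
      rw [show -(x * (τ - ρ)) = x * ρ + -(x * τ) by ring, Real.exp_add]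
      ring

/-- The weights `e^{-c n²}`, which measure the decay of the heat semigroup on the `n`-th mode. -/
def gaussWeight (c : ℝ) (n : ℕ) : ℝ := Real.exp (-c * (n : ℝ) ^ 2)

theorem gaussWeight_pos (c : ℝ) (n : ℕ) : 0 < gaussWeight c n := Real.exp_pos _

theorem summable_gaussWeight {c : ℝ} (hc : 0 < c) : Summable (gaussWeight c) := by
  refine Summable.of_nonneg_of_le (fun n => (gaussWeight_pos c n).le) (fun n => ?_)
    (summable_geometric_of_lt_one (Real.exp_pos (-c)).le (Real.exp_lt_one_iff.2 (by linarith)))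
  have : (n : ℝ) ≤ (n : ℝ) ^ 2 := mod_cast Nat.le_self_pow two_ne_zero n
  rw [← Real.exp_nat_mul, gaussWeight]
  exact Real.exp_le_exp.2 (by nlinarith)

theorem gaussWeight_antitone {c : ℝ} (hc : 0 ≤ c) : Antitone (gaussWeight c) := fun m n h => by
  have : (m : ℝ) ^ 2 ≤ (n : ℝ) ^ 2 := by gcongr
  exact Real.exp_le_exp.2 (by nlinarith)

/-- Half of the decay rate left to the modes after the factor `e^{-n²π²ρ}` has been spent on the
powers of `n`; the other half is kept to sum over the modes. -/
def decayRate (τ ρ : ℝ) : ℝ := Real.pi ^ 2 * (τ - ρ) / 2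

theorem decayRate_pos {τ ρ : ℝ} (h : ρ < τ) : 0 < decayRate τ ρ := by
  have := sub_pos.2 h
  rw [decayRate]
  positivity

theorem abs_outputCoeffTerm_mul_le {τ ρ : ℝ} (θ₀ : L2) (hρ : 0 < ρ) (hρτ : ρ ≤ τ) (k : ℕ)
    {N n : ℕ} (hn : N ≤ n) :
    |outputCoeffTerm τ θ₀ k n * (-Real.pi ^ 2) ^ k| ≤
      ‖θ₀‖ * gaussWeight (decayRate τ ρ) N * (k ! / ρ ^ k) * gaussWeight (decayRate τ ρ) n := by
  have hc : 0 ≤ decayRate τ ρ := by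
    have := sub_nonneg.2 hρτ
    rw [decayRate]
    positivity
  have hsq : Real.exp (-((n : ℝ) ^ 2 * Real.pi ^ 2 * (τ - ρ))) =
      gaussWeight (decayRate τ ρ) n * gaussWeight (decayRate τ ρ) n := by
    rw [gaussWeight, ← Real.exp_add, decayRate]
    ring_nf
  rw [outputCoeffTerm, abs_mul, abs_mul, abs_mul, Real.abs_exp, abs_pow, abs_pow, Nat.abs_cast,
    abs_neg, abs_sq]
  calc |cosCoeff θ₀ n| * Real.exp (-(n : ℝ) ^ 2 * Real.pi ^ 2 * τ) * (n : ℝ) ^ (2 * k) *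
        (Real.pi ^ 2) ^ k
      = |cosCoeff θ₀ n| * (((n : ℝ) ^ 2 * Real.pi ^ 2) ^ k *
          Real.exp (-((n : ℝ) ^ 2 * Real.pi ^ 2 * τ))) := by
        rw [pow_mul, mul_pow, ← neg_mul, ← neg_mul]
        ring
    _ ≤ ‖θ₀‖ * (k ! / ρ ^ k * Real.exp (-((n : ℝ) ^ 2 * Real.pi ^ 2 * (τ - ρ)))) := by
        gcongr ?_ * ?_
        exacts [abs_cosCoeff_le θ₀ n, pow_mul_exp_neg_le (by positivity) hρ k]
    _ = ‖θ₀‖ * (k ! / ρ ^ k * (gaussWeight (decayRate τ ρ) n * gaussWeight (decayRate τ ρ) n)) := by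
        rw [hsq]
    _ ≤ ‖θ₀‖ * (k ! / ρ ^ k * (gaussWeight (decayRate τ ρ) N * gaussWeight (decayRate τ ρ) n)) := by
        have := gaussWeight_pos (decayRate τ ρ) n
        gcongr
        exact gaussWeight_antitone hc hn
    _ = _ := by ring

theorem summable_outputCoeffTerm {τ : ℝ} (θ₀ : L2) (hτ : 0 < τ) (k : ℕ) :
    Summable (outputCoeffTerm τ θ₀ k) := by
  have hπ : (-Real.pi ^ 2) ^ k ≠ 0 := by simp [Real.pi_ne_zero]
  refine (summable_mul_right_iff hπ).1 <| .of_norm_bounded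
    ((summable_gaussWeight (decayRate_pos (half_lt_self hτ))).mul_left _) fun n =>
      abs_outputCoeffTerm_mul_le θ₀ (half_pos hτ) (half_le_self hτ.le) k n.zero_le

/-- The part of `y_k` carried by the modes `n ≥ N`. -/
def outputCoeffTail (τ : ℝ) (θ₀ : L2) (N k : ℕ) : ℝ :=
  √2 * (∑' n : ℕ, outputCoeffTerm τ θ₀ k (n + N)) * (-Real.pi ^ 2) ^ k

theorem outputCoeffTail_zero (τ : ℝ) (θ₀ : L2) : outputCoeffTail τ θ₀ 0 = outputCoeff τ θ₀ := rfl

theorem outputCoeff_sub_truncOutputCoeff {τ : ℝ} (θ₀ : L2) (hτ : 0 < τ) (N k : ℕ) :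
    outputCoeff τ θ₀ k - truncOutputCoeff τ θ₀ N k = outputCoeffTail τ θ₀ (N + 1) k := by
  rw [outputCoeff, truncOutputCoeff, outputCoeffTail,
    ← (summable_outputCoeffTerm θ₀ hτ k).sum_add_tsum_nat_add (N + 1)]
  ring

/-- The constant in Cauchy's estimates for the Taylor coefficients of the flat output. -/
def outputConst (τ ρ : ℝ) : ℝ := √2 * ∑' n, gaussWeight (decayRate τ ρ) n

theorem outputConst_pos {τ ρ : ℝ} (hρτ : ρ < τ) : 0 < outputConst τ ρ :=
  mul_pos (by positivity) ((summable_gaussWeight (decayRate_pos hρτ)).tsum_pos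
    (fun n => (gaussWeight_pos _ n).le) 0 (gaussWeight_pos _ 0))

theorem cauchyEstimate_outputCoeffTail {τ ρ : ℝ} (θ₀ : L2) (hρ : 0 < ρ) (hρτ : ρ < τ) (N : ℕ) :
    CauchyEstimate (outputConst τ ρ * gaussWeight (decayRate τ ρ) N * ‖θ₀‖) ρ
      (outputCoeffTail τ θ₀ N) := fun k => by
  have hw := summable_gaussWeight (decayRate_pos hρτ)
  have hshift : ∑' n, gaussWeight (decayRate τ ρ) (n + N) ≤
      ∑' n, gaussWeight (decayRate τ ρ) n := by
    rw [← hw.sum_add_tsum_nat_add N]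
    exact le_add_of_nonneg_left (Finset.sum_nonneg fun n _ => (gaussWeight_pos _ n).le)
  have htail : |∑' n, outputCoeffTerm τ θ₀ k (n + N) * (-Real.pi ^ 2) ^ k| ≤
      ‖θ₀‖ * gaussWeight (decayRate τ ρ) N * (k ! / ρ ^ k) *
        ∑' n, gaussWeight (decayRate τ ρ) (n + N) :=
    tsum_of_norm_bounded (f := fun n => outputCoeffTerm τ θ₀ k (n + N) * (-Real.pi ^ 2) ^ k)
      (((summable_nat_add_iff N).2 hw).hasSum.mul_left _) fun n =>
        abs_outputCoeffTerm_mul_le θ₀ hρ hρτ.le k (Nat.le_add_left N n)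
  have := gaussWeight_pos (decayRate τ ρ) N
  rw [outputCoeffTail, mul_assoc, ← tsum_mul_right, abs_mul, abs_of_nonneg (Real.sqrt_nonneg 2)]
  calc √2 * |∑' n, outputCoeffTerm τ θ₀ k (n + N) * (-Real.pi ^ 2) ^ k|
      ≤ √2 * (‖θ₀‖ * gaussWeight (decayRate τ ρ) N * (k ! / ρ ^ k) *
          ∑' n, gaussWeight (decayRate τ ρ) n) := by
        gcongr
        exact htail.trans (by gcongr)
    _ = _ := by
        rw [outputConst]
        ring

theorem cauchyEstimate_outputCoeff {τ ρ : ℝ} (θ₀ : L2) (hρ : 0 < ρ) (hρτ : ρ < τ) :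
    CauchyEstimate (outputConst τ ρ * ‖θ₀‖) ρ (outputCoeff τ θ₀) := by
  simpa [gaussWeight, outputCoeffTail_zero] using cauchyEstimate_outputCoeffTail θ₀ hρ hρτ 0

theorem CauchyEstimate.sub_indicator_Iic {A B ρ ρ' : ℝ} {d e : ℕ → ℝ} (hd : CauchyEstimate A ρ d)
    (hde : CauchyEstimate B ρ fun k => d k - e k) (hρ' : 0 < ρ') (hρ : ρ' ≤ ρ) (K : ℕ) :
    CauchyEstimate (A * Real.exp (-Real.log (ρ / ρ') * K) + B) ρ'
      fun k => d k - (Iic K).indicator e k := fun k => by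
  have hA := hd.nonneg
  have hB := hde.nonneg
  have hρ0 : 0 < ρ := hρ'.trans_le hρ
  by_cases hk : k ≤ K
  · dsimp only
    rw [indicator_of_mem (mem_Iic.2 hk)]
    exact hde.mono (le_add_of_nonneg_left (by positivity)) hρ' hρ k
  · have hexp : Real.exp (-Real.log (ρ / ρ') * K) = (ρ' / ρ) ^ K := by
      rw [mul_comm, Real.exp_nat_mul, Real.exp_neg, Real.exp_log (by positivity), inv_div]
    dsimp only
    rw [indicator_of_notMem (mt mem_Iic.1 hk), sub_zero, hexp]
    calc |d k| ≤ A * (k ! / ρ ^ k) := hd k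
      _ = A * (ρ' / ρ) ^ k * (k ! / ρ' ^ k) := by
        rw [div_pow]
        field_simp
      _ ≤ (A * (ρ' / ρ) ^ K + B) * (k ! / ρ' ^ k) := by
        gcongr
        refine le_add_of_le_of_nonneg ?_ hB
        gcongr A * ?_
        exact pow_le_pow_of_le_one (by positivity) ((div_le_one hρ0).2 hρ) (by omega)

theorem cauchyEstimate_outputCoeff_sub_truncOutputCoeff {τ ρ ρ' : ℝ} (θ₀ : L2) (hρ' : 0 < ρ')
    (hρ : ρ' ≤ ρ) (hρτ : ρ < τ) (K N : ℕ) :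
    CauchyEstimate (outputConst τ ρ * (Real.exp (-Real.log (ρ / ρ') * K) +
        Real.exp (-decayRate τ ρ * (N : ℝ) ^ 2)) * ‖θ₀‖) ρ'
      fun k => outputCoeff τ θ₀ k - (Iic K).indicator (truncOutputCoeff τ θ₀ N) k := by
  have hρ0 : 0 < ρ := hρ'.trans_le hρ
  have htail : CauchyEstimate (outputConst τ ρ * gaussWeight (decayRate τ ρ) N * ‖θ₀‖) ρ
      fun k => outputCoeff τ θ₀ k - truncOutputCoeff τ θ₀ N k := by
    simp only [outputCoeff_sub_truncOutputCoeff θ₀ (hρ0.trans hρτ)]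
    refine (cauchyEstimate_outputCoeffTail θ₀ hρ0 hρτ (N + 1)).mono ?_ hρ0 le_rfl
    have := outputConst_pos hρτ
    gcongr
    exact gaussWeight_antitone (decayRate_pos hρτ).le N.le_succ
  refine ((cauchyEstimate_outputCoeff θ₀ hρ0 hρτ).sub_indicator_Iic htail hρ' hρ K).mono
    (le_of_eq ?_) hρ' le_rfl
  rw [gaussWeight]
  ring

theorem flatOutput_eq_cutoffSeries (s τ R' : ℝ) (θ₀ : L2) :
    flatOutput s τ R' θ₀ = cutoffSeries s τ R' (outputCoeff τ θ₀) := rfl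

theorem truncFlatOutput_eq_cutoffSeries (s τ R' : ℝ) (θ₀ : L2) (K N : ℕ) :
    truncFlatOutput s τ R' θ₀ K N =
      cutoffSeries s τ R' ((Iic K).indicator (truncOutputCoeff τ θ₀ N)) := by
  ext t
  rw [truncFlatOutput, cutoffSeries, taylorSum, tsum_eq_sum (s := Finset.range (K + 1))]
  · refine congrArg _ (Finset.sum_congr rfl fun k hk => ?_)
    rw [indicator_of_mem (mem_Iic.2 (Finset.mem_range_succ_iff.1 hk))]
  · intro k hk
    rw [indicator_of_notMem (mt (Finset.mem_range_succ_iff.2 ∘ mem_Iic.1) hk), zero_mul, zero_div]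

theorem contDiff_truncFlatOutput {s : ℝ} (hs : 1 < s) (τ R' : ℝ) (θ₀ : L2) (K N : ℕ) :
    ContDiff ℝ (⊤ : ℕ∞) (truncFlatOutput s τ R' θ₀ K N) := by
  obtain ⟨A, M, -, -, hstep⟩ := exists_gevreyAt_step hs
  have hφ : ContDiff ℝ (⊤ : ℕ∞) (step s) := contDiff_iff_contDiffAt.2 fun x => (hstep x).contDiffAt
  unfold truncFlatOutput
  fun_prop

theorem exists_gevreyAt_flatOutput {s τ R' : ℝ} (hs : 1 < s) (hR' : 0 < R') (hR'τ : R' < τ) :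
    ∃ A M : ℝ, 0 < M ∧ ∀ (θ₀ : L2) (t : ℝ), τ ≤ t →
      GevreyAt s (A * ‖θ₀‖) M (flatOutput s τ R' θ₀) t := by
  obtain ⟨ρ, hρ, hρτ⟩ := exists_between hR'τ
  obtain ⟨C, M, -, hM, hgevrey⟩ := exists_gevreyAt_cutoffSeries hs hR' hρ
  refine ⟨outputConst τ ρ * C, M, hM, fun θ₀ t ht => ?_⟩
  have := hgevrey τ _ _ (cauchyEstimate_outputCoeff θ₀ (hR'.trans hρ) hρτ) t ht
  rwa [mul_right_comm] at this

theorem exists_gevreyAt_flatOutput_sub_truncFlatOutput {s τ R' : ℝ} (hs : 1 < s) (hR' : 0 < R')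
    (hR'τ : R' < τ) :
    ∃ A M C₂ C₃ : ℝ, 0 < A ∧ 0 < M ∧ 0 < C₂ ∧ 0 < C₃ ∧ ∀ (θ₀ : L2) (t : ℝ), τ ≤ t →
      GevreyAt s (A * ‖θ₀‖) M (flatOutput s τ R' θ₀) t ∧ ∀ K N : ℕ,
      GevreyAt s (A * (Real.exp (-C₂ * K) + Real.exp (-C₃ * (N : ℝ) ^ 2)) * ‖θ₀‖) M
        (fun t => flatOutput s τ R' θ₀ t - truncFlatOutput s τ R' θ₀ K N t) t := by
  obtain ⟨ρ', hρ', hρ'τ⟩ := exists_between hR'τ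
  obtain ⟨ρ, hρ, hρτ⟩ := exists_between hρ'τ
  have hρ'0 : 0 < ρ' := hR'.trans hρ'
  obtain ⟨C, M, hC, hM, hgevrey⟩ := exists_gevreyAt_cutoffSeries hs hR' hρ'
  refine ⟨outputConst τ ρ * C, M, Real.log (ρ / ρ'), decayRate τ ρ,
    mul_pos (outputConst_pos hρτ) hC, hM, Real.log_pos ((one_lt_div hρ'0).2 hρ),
    decayRate_pos hρτ, fun θ₀ t ht => ?_⟩
  have hd := (cauchyEstimate_outputCoeff θ₀ (hρ'0.trans hρ) hρτ).mono le_rfl hρ'0 hρ.le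
  refine ⟨(hgevrey τ _ _ hd t ht).mono le_rfl (by rw [mul_right_comm]) hM.le le_rfl,
    fun K N => ?_⟩
  have hde := cauchyEstimate_outputCoeff_sub_truncOutputCoeff θ₀ hρ'0 hρ.le hρτ K N
  have he := hd.sub hde
  simp only [sub_sub_cancel] at he
  refine ((hgevrey τ _ _ hde t ht).congr_of_eventuallyEq ?_).mono le_rfl (le_of_eq (by ring))
    hM.le le_rfl
  filter_upwards [Ioi_mem_nhds (show τ - ρ' < t by linarith)] with u hu
  rw [flatOutput_eq_cutoffSeries, truncFlatOutput_eq_cutoffSeries,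
    cutoffSeries_sub hR' hρ' hd he hu]

/-! ### The controls -/

theorem control_of_lt {s τ R' t : ℝ} (θ₀ : L2) (ht : τ < t) :
    control s τ R' θ₀ t = ∑' i, controlTerm (flatOutput s τ R' θ₀) i t := if_neg ht.not_ge

theorem truncControl_of_lt {s τ R' t : ℝ} (θ₀ : L2) (I K N : ℕ) (ht : τ < t) :
    truncControl s τ R' θ₀ I K N t =
      ∑ i ∈ Finset.range I, controlTerm (truncFlatOutput s τ R' θ₀ K N) i t := if_neg ht.not_ge

theorem controlWellDefined {s τ R' : ℝ} (T : ℝ) (θ₀ : L2) (hs₁ : 1 < s) (hs₂ : s < 2)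
    (hR' : 0 < R') (hR'τ : R' < τ) : ControlWellDefined T s τ R' θ₀ := by
  obtain ⟨A, M, hM, hgevrey⟩ := exists_gevreyAt_flatOutput hs₁ hR' hR'τ
  obtain ⟨ρ, hρ, hρτ⟩ := exists_between hR'τ
  refine ⟨summable_outputCoeffTerm θ₀ (hR'.trans hR'τ), fun t ht => ?_,
    fun t ht => (hgevrey θ₀ t ht.1).contDiffAt,
    fun t ht => (hgevrey θ₀ t ht.1).summable_controlTerm hs₂ hM⟩
  have hρ0 : 0 < ρ := hR'.trans hρ
  exact (cauchyEstimate_outputCoeff θ₀ hρ0 hρτ).summable hρ0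
    (abs_lt.2 ⟨by linarith [ht.1], by linarith [ht.2]⟩)

theorem memLp_ite_le {v : ℝ → ℝ} {τ : ℝ} (hv : ContinuousOn v (Ici τ)) (p : ENNReal) (a b : ℝ) :
    MemLp (fun t => if t ≤ τ then 0 else v t) p (volume.restrict (Ioo a b)) := by
  obtain ⟨B, hB⟩ := isCompact_Icc.exists_bound_of_continuousOn
    (hv.mono (Icc_subset_Ici_self : Icc τ b ⊆ Ici τ))
  have hind : (fun t => if t ≤ τ then 0 else v t) = (Ioi τ).indicator v := by
    ext t
    simp only [indicator_apply, mem_Ioi, ← not_le, ite_not]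
  rw [hind]
  refine MemLp.of_bound ((aestronglyMeasurable_indicator_iff measurableSet_Ioi).2 ?_) (max B 0) ?_
  · exact ((hv.mono Ioi_subset_Ici_self).aestronglyMeasurable measurableSet_Ioi).mono_measure
      (Measure.restrict_mono le_rfl Measure.restrict_le_self)
  · filter_upwards [ae_restrict_mem measurableSet_Ioo] with t ht
    by_cases hτ : t ∈ Ioi τ
    · rw [indicator_of_mem hτ]
      exact (hB t ⟨(mem_Ioi.1 hτ).le, ht.2.le⟩).trans (le_max_left _ _)
    · simp [indicator_of_notMem hτ]

theorem memLp_control {s τ R' : ℝ} (T : ℝ) (θ₀ : L2) (hs₁ : 1 < s) (hs₂ : s < 2)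
    (hR' : 0 < R') (hR'τ : R' < τ) :
    MemLp (control s τ R' θ₀) 2 (volume.restrict (Ioo 0 T)) := by
  obtain ⟨A, M, hM, hgevrey⟩ := exists_gevreyAt_flatOutput hs₁ hR' hR'τ
  exact memLp_ite_le (continuousOn_tsum
    (continuousOn_controlTerm fun t ht => (hgevrey θ₀ t (mem_Ici.1 ht)).contDiffAt)
    ((summable_controlWeight hs₂ hM).mul_left (A * ‖θ₀‖))
    fun i t ht => (hgevrey θ₀ t (mem_Ici.1 ht)).abs_controlTerm_le hs₂ hM.le i) 2 0 T

theorem memLp_truncControl {s : ℝ} (T τ R' : ℝ) (θ₀ : L2) (hs : 1 < s) (I K N : ℕ) :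
    MemLp (truncControl s τ R' θ₀ I K N) 2 (volume.restrict (Ioo 0 T)) :=
  memLp_ite_le (continuousOn_finsetSum _ fun i _ => continuousOn_controlTerm
    (fun _ _ => (contDiff_truncFlatOutput hs τ R' θ₀ K N).contDiffAt) i) 2 0 T

theorem exists_abs_control_sub_truncControl_le {s τ R' : ℝ} (hs₁ : 1 < s) (hs₂ : s < 2)
    (hR' : 0 < R') (hR'τ : R' < τ) :
    ∃ C C₁ C₂ C₃ : ℝ, 0 < C ∧ 0 < C₁ ∧ 0 < C₂ ∧ 0 < C₃ ∧ ∀ (θ₀ : L2) (I K N : ℕ) (t : ℝ),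
      |control s τ R' θ₀ t - truncControl s τ R' θ₀ I K N t| ≤
        C * (Real.exp (-C₁ * ((I : ℝ) * Real.log I)) + Real.exp (-C₂ * K) +
          Real.exp (-C₃ * (N : ℝ) ^ 2)) * ‖θ₀‖ := by
  obtain ⟨A, M, C₂, C₃, hA, hM, hC₂, hC₃, hgevrey⟩ :=
    exists_gevreyAt_flatOutput_sub_truncFlatOutput hs₁ hR' hR'τ
  have hW : 0 < ∑' i, controlWeight s M i := (summable_controlWeight hs₂ hM).tsum_pos
    (fun i => (controlWeight_pos hM i).le) 0 (controlWeight_pos hM 0)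
  refine ⟨A * ∑' i, controlWeight s M i, (2 - s) / 4, C₂, C₃, mul_pos hA hW, by linarith, hC₂, hC₃,
    fun θ₀ I K N t => ?_⟩
  rcases le_or_gt t τ with ht | ht
  · rw [control, truncControl, if_pos ht, if_pos ht, sub_zero, abs_zero]
    positivity
  · obtain ⟨hy, hyz⟩ := hgevrey θ₀ t ht.le
    rw [control_of_lt θ₀ ht, truncControl_of_lt θ₀ I K N ht]
    refine (hy.abs_tsum_controlTerm_sub_sum_le
      (contDiff_truncFlatOutput hs₁ τ R' θ₀ K N).contDiffAt (hyz K N) hs₂ hM I).trans (le_of_eq ?_)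
    ring

end Gevrey

/-! ### The scalar modes -/

section ModeSol

variable {l c t T : ℝ} {v : ℝ → ℝ}

theorem exp_mul_add_integral_eq {f : ℝ → ℝ} (hf : IntervalIntegrable f volume 0 t) :
    Real.exp (l * t) * (c + ∫ r in (0 : ℝ)..t, f r) =
      c + ∫ r in (0 : ℝ)..t,
        Real.exp (l * r) * (f r + l * (c + ∫ ρ in (0 : ℝ)..r, f ρ)) := by
  have hexp (r : ℝ) : HasDerivAt (fun r => Real.exp (l * r)) (Real.exp (l * r) * l) r :=
    (hasDerivAt_const_mul l).exp
  have hexpAC : AbsolutelyContinuousOnInterval (fun r => Real.exp (l * r)) 0 t :=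
    ContDiffOn.absolutelyContinuousOnInterval (ContDiff.contDiffOn (by fun_prop))
  have hprimAC : AbsolutelyContinuousOnInterval (fun r => c + ∫ ρ in (0 : ℝ)..r, f ρ) 0 t :=
    (ContDiffOn.absolutelyContinuousOnInterval contDiffOn_const).fun_add
      (hf.absolutelyContinuousOnInterval_intervalIntegral (c := 0) (by simp))
  have hparts := hexpAC.integral_deriv_mul_eq_sub hprimAC
  rw [mul_zero, Real.exp_zero, intervalIntegral.integral_same, add_zero, one_mul,
    eq_sub_iff_add_eq'] at hparts
  rw [← hparts]
  refine congrArg (c + ·) (intervalIntegral.integral_congr_ae ?_)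
  filter_upwards [hf.ae_hasDerivAt_integral] with r hr hrt
  rw [(hexp r).deriv, ((hr (uIoc_subset_uIcc hrt) 0 (by simp)).const_add c).deriv]
  ring

/-- Duhamel's formula for the solution of `a' = -l a + v`, `a(0) = c`. -/
def modeSol (l c : ℝ) (v : ℝ → ℝ) (t : ℝ) : ℝ :=
  Real.exp (-l * t) * (c + ∫ r in (0 : ℝ)..t, Real.exp (l * r) * v r)

theorem modeSol_apply_zero : modeSol l c v 0 = c := by
  simp [modeSol]

theorem intervalIntegrable_exp_mul (hv : IntervalIntegrable v volume 0 t) :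
    IntervalIntegrable (fun r => Real.exp (l * r) * v r) volume 0 t :=
  hv.continuousOn_mul (by fun_prop)

theorem modeSol_eq_add_integral (hv : IntervalIntegrable v volume 0 t) :
    modeSol l c v t = c + ∫ r in (0 : ℝ)..t, (-l * modeSol l c v r + v r) := by
  rw [modeSol, exp_mul_add_integral_eq (intervalIntegrable_exp_mul hv)]
  refine congrArg (c + ·) (intervalIntegral.integral_congr fun r _ => ?_)
  have hcancel : Real.exp (-l * r) * Real.exp (l * r) = 1 := by
    rw [← Real.exp_add, neg_mul, neg_add_cancel, Real.exp_zero]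
  simp only [modeSol]
  linear_combination v r * hcancel

theorem eq_modeSol {w : ℝ → ℝ} (hv : IntervalIntegrable v volume 0 t)
    (hwc : ContinuousOn w (uIcc 0 t))
    (hw : ∀ r ∈ uIcc 0 t, w r = c + ∫ ρ in (0 : ℝ)..r, (-l * w ρ + v ρ)) :
    w t = modeSol l c v t := by
  have hf : IntervalIntegrable (fun r => -l * w r + v r) volume 0 t :=
    (continuousOn_const.mul hwc).intervalIntegrable.add hv
  have hexp : Real.exp (l * t) * w t = c + ∫ r in (0 : ℝ)..t, Real.exp (l * r) * v r := by
    rw [hw t right_mem_uIcc, exp_mul_add_integral_eq hf]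
    refine congrArg (c + ·) (intervalIntegral.integral_congr fun r hr => ?_)
    rw [← hw r hr]
    ring
  rw [modeSol, ← hexp, ← mul_assoc, ← Real.exp_add, neg_mul, neg_add_cancel, Real.exp_zero,
    one_mul]

theorem continuousOn_modeSol (hv : IntervalIntegrable v volume 0 T) :
    ContinuousOn (modeSol l c v) (uIcc 0 T) :=
  ContinuousOn.mul (by fun_prop) (continuousOn_const.add
    (intervalIntegral.continuousOn_primitive_interval' (intervalIntegrable_exp_mul hv)
      left_mem_uIcc))

theorem modeSol_sub {v' : ℝ → ℝ} (hv : IntervalIntegrable v volume 0 t)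
    (hv' : IntervalIntegrable v' volume 0 t) :
    modeSol l c v t - modeSol l c v' t = modeSol l 0 (fun r => v r - v' r) t := by
  simp only [modeSol, mul_sub]
  rw [intervalIntegral.integral_sub (intervalIntegrable_exp_mul hv)
    (intervalIntegrable_exp_mul hv')]
  ring

theorem modeSol_zero_initial :
    modeSol l 0 v t = ∫ r in (0 : ℝ)..t, Real.exp (-l * (t - r)) * v r := by
  rw [modeSol, zero_add, ← intervalIntegral.integral_const_mul]
  refine intervalIntegral.integral_congr fun r _ => ?_
  rw [← mul_assoc, ← Real.exp_add]
  ring_nf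

theorem exp_neg_mul_sub_le_one (hl : 0 ≤ l) {r : ℝ} (hr : r ≤ t) :
    Real.exp (-l * (t - r)) ≤ 1 :=
  Real.exp_le_one_iff.2 (mul_nonpos_of_nonpos_of_nonneg (neg_nonpos.2 hl) (sub_nonneg.2 hr))

theorem integral_one_add_mul_exp_le (hl : 0 ≤ l) (ht : 0 ≤ t) :
    ∫ r in (0 : ℝ)..t, (1 + l) * Real.exp (-l * (t - r)) ≤ 1 + t := by
  have hle : ∫ r in (0 : ℝ)..t, Real.exp (-l * (t - r)) ≤ t := by
    refine (intervalIntegral.integral_mono_on (g := fun _ => 1) ht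
      (Continuous.intervalIntegrable (by fun_prop) _ _) intervalIntegrable_const
      fun r hr => exp_neg_mul_sub_le_one hl hr.2).trans_eq ?_
    simp
  have hderiv (r : ℝ) : HasDerivAt (fun r => Real.exp (-l * (t - r)))
      (l * Real.exp (-l * (t - r))) r :=
    (((hasDerivAt_id' r).const_sub t).const_mul (-l)).exp.congr_deriv (by ring)
  have hmul : l * ∫ r in (0 : ℝ)..t, Real.exp (-l * (t - r)) = 1 - Real.exp (-l * t) := by
    rw [← intervalIntegral.integral_const_mul, intervalIntegral.integral_eq_sub_of_hasDerivAt
      (fun r _ => hderiv r) (Continuous.intervalIntegrable (by fun_prop) _ _)]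
    simp
  rw [intervalIntegral.integral_const_mul, add_mul, hmul]
  linarith [Real.exp_pos (-l * t)]

theorem one_add_mul_abs_modeSol_le {ε : ℝ} (hl : 0 ≤ l) (ht : 0 ≤ t)
    (hv : ∀ r ∈ Ioc 0 t, |v r| ≤ ε) (hε : 0 ≤ ε) :
    (1 + l) * |modeSol l 0 v t| ≤ (1 + t) * ε := by
  have hnorm : |modeSol l 0 v t| ≤ ∫ r in (0 : ℝ)..t, Real.exp (-l * (t - r)) * ε := by
    rw [modeSol_zero_initial]
    refine intervalIntegral.norm_integral_le_of_norm_le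
      (f := fun r => Real.exp (-l * (t - r)) * v r) ht (Eventually.of_forall fun r hr => ?_)
      (Continuous.intervalIntegrable (by fun_prop) _ _)
    rw [norm_mul, Real.norm_of_nonneg (Real.exp_pos _).le]
    exact mul_le_mul_of_nonneg_left (hv r hr) (Real.exp_pos _).le
  calc (1 + l) * |modeSol l 0 v t|
      ≤ (1 + l) * ∫ r in (0 : ℝ)..t, Real.exp (-l * (t - r)) * ε := by gcongr
    _ = (∫ r in (0 : ℝ)..t, (1 + l) * Real.exp (-l * (t - r))) * ε := by
      rw [intervalIntegral.integral_mul_const, intervalIntegral.integral_const_mul, mul_assoc]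
    _ ≤ (1 + t) * ε := by
      gcongr
      exact integral_one_add_mul_exp_le hl ht

theorem sqrt_one_add_mul_abs_modeSol_le (hl : 0 ≤ l) (ht : 0 ≤ t)
    (hv : IntervalIntegrable (fun r => v r ^ 2) volume 0 t) :
    √(1 + l) * |modeSol l 0 v t| ≤ (1 + t + ∫ r in (0 : ℝ)..t, v r ^ 2) / 2 := by
  have hkernel : IntervalIntegrable (fun r => (1 + l) * Real.exp (-l * (t - r))) volume 0 t :=
    Continuous.intervalIntegrable (by fun_prop) _ _
  have hpoint (r : ℝ) (hr : r ∈ Ioc 0 t) : ‖√(1 + l) * (Real.exp (-l * (t - r)) * v r)‖ ≤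
      ((1 + l) * Real.exp (-l * (t - r)) + v r ^ 2) / 2 := by
    set e := Real.exp (-l * (t - r))
    have he : 0 < e := Real.exp_pos _
    have hsq : e ^ 2 ≤ e := by
      simpa using pow_le_of_le_one he.le (exp_neg_mul_sub_le_one hl hr.2) two_ne_zero
    have hamgm := two_mul_le_add_sq (√(1 + l) * e) |v r|
    rw [mul_pow, Real.sq_sqrt (by positivity), sq_abs] at hamgm
    rw [norm_mul, norm_mul, Real.norm_of_nonneg (Real.sqrt_nonneg _), Real.norm_of_nonneg he.le,
      Real.norm_eq_abs]
    nlinarith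
  rw [modeSol_zero_initial, ← abs_of_nonneg (Real.sqrt_nonneg (1 + l)), ← abs_mul,
    ← intervalIntegral.integral_const_mul]
  refine (intervalIntegral.norm_integral_le_of_norm_le ht (Eventually.of_forall hpoint)
    ((hkernel.add hv).div_const 2)).trans ?_
  rw [intervalIntegral.integral_div, intervalIntegral.integral_add hkernel hv]
  gcongr
  exact integral_one_add_mul_exp_le hl ht

theorem abs_modeSol_le_add (hl : 0 ≤ l) (ht : 0 ≤ t) :
    |modeSol l c v t| ≤ |c| + |modeSol l 0 v t| := by
  have hexp : Real.exp (-l * t) ≤ 1 := by simpa using exp_neg_mul_sub_le_one hl ht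
  have hsplit : modeSol l c v t = Real.exp (-l * t) * c + modeSol l 0 v t := by
    rw [modeSol, modeSol]
    ring
  rw [hsplit]
  refine (abs_add_le _ _).trans (add_le_add_left ?_ _)
  rw [abs_mul, Real.abs_exp]
  exact mul_le_of_le_one_left (abs_nonneg c) hexp

end ModeSol

/-! ### Solutions of the heat equation -/

theorem continuousOn_of_modeCoeff {θ : ℝ → L2} {S : Set ℝ} {b : ℕ → ℝ}
    (hb : Summable fun n => b n ^ 2) (hc : ∀ n, ContinuousOn (fun t => modeCoeff (θ t) n) S)
    (hle : ∀ n, ∀ t ∈ S, |modeCoeff (θ t) n| ≤ b n) : ContinuousOn θ S := by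
  intro t₀ ht₀
  rw [ContinuousWithinAt, tendsto_iff_norm_sub_tendsto_zero]
  have hsq : Tendsto (fun t => ∑' n, modeCoeff (θ t - θ t₀ : L2) n ^ 2) (𝓝[S] t₀)
      (𝓝 (∑' _ : ℕ, (0 : ℝ))) := by
    refine tendsto_tsum_of_dominated_convergence (hb.mul_left 4) (fun n => ?_) ?_
    · have hmode := ((hc n t₀ ht₀).tendsto.sub_const (modeCoeff (θ t₀) n)).pow 2
      simp only [modeCoeff_sub]
      simpa only [sub_self, zero_pow two_ne_zero] using hmode
    · filter_upwards [self_mem_nhdsWithin] with t ht n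
      have habs : |modeCoeff (θ t) n - modeCoeff (θ t₀) n| ≤ 2 * b n :=
        (abs_sub _ _).trans (by linarith [hle n t ht, hle n t₀ ht₀])
      rw [modeCoeff_sub, Real.norm_of_nonneg (sq_nonneg _)]
      exact (sq_le_sq' (abs_le.1 habs).1 (abs_le.1 habs).2).trans_eq (by ring)
  rw [tsum_zero] at hsq
  have hnorm := (Real.continuous_sqrt.tendsto _).comp hsq
  rw [Real.sqrt_zero] at hnorm
  refine hnorm.congr fun t => ?_
  rw [Function.comp_apply, (hasSum_modeCoeff_sq _).tsum_eq, Real.sqrt_sq (norm_nonneg _)]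

theorem eLpNorm_top_le_tsum_abs_modeCoeff {f : L2} (hf : Summable fun n => |modeCoeff f n|) :
    eLpNorm f ⊤ unitMeasure ≤ ENNReal.ofReal (√2 * ∑' n, |modeCoeff f n|) := by
  have hbound : ∀ᵐ x ∂unitMeasure, ‖f x‖ ≤ √2 * ∑' n, |modeCoeff f n| := by
    filter_upwards [ae_eq_cosSeries hf] with x hx
    rw [hx]
    refine tsum_of_norm_bounded (hf.hasSum.mul_left √2) fun n => ?_
    rw [norm_mul, mul_comm]
    exact mul_le_mul_of_nonneg_right (abs_cosMode_le n x) (abs_nonneg _)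
  refine (eLpNorm_le_of_ae_bound hbound).trans_eq ?_
  simp

theorem IsNeumann.hasSum_cosMode {φ : ℝ → ℝ} (hφ : IsNeumann φ) {x : ℝ} (hx : x ∈ Icc (0 : ℝ) 1) :
    HasSum (fun n => modeCoeff φ n * cosMode n x) (φ x) := by
  rw [eq_cosSeries hφ.contDiff.continuous hφ.summable_abs_modeCoeff hx]
  refine (Summable.of_norm_bounded (hφ.summable_abs_modeCoeff.mul_right √2) fun n => ?_).hasSum
  rw [norm_mul]
  exact mul_le_mul_of_nonneg_left (abs_cosMode_le n x) (abs_nonneg _)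

section Existence

variable {T t : ℝ} {u : ℝ → ℝ} {θ₀ : L2} {θ : ℝ → L2} {φ : ℝ → ℝ}

theorem intervalIntegrable_of_memLp (hu : MemLp u 2 (volume.restrict (Ioo (0 : ℝ) T)))
    (ht : t ∈ Icc 0 T) : IntervalIntegrable u volume 0 t :=
  (intervalIntegrable_iff_integrableOn_Ioo_of_le ht.1).2
    (IntegrableOn.mono_set (hu.integrable one_le_two) (Ioo_subset_Ioo_right ht.2))

/-- The `n`-th mode of the solution with control `u` starting from `θ₀`. -/
def heatMode (u : ℝ → ℝ) (θ₀ : L2) (n : ℕ) (t : ℝ) : ℝ :=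
  modeSol (eigen n) (modeCoeff θ₀ n) (fun r => u r * cosMode n 1) t

/-- A majorant on `[0,T]` of the `n`-th mode of the solution. -/
def modeBound (T : ℝ) (u : ℝ → ℝ) (θ₀ : L2) (n : ℕ) : ℝ :=
  |modeCoeff θ₀ n| + (1 + T + 2 * ∫ r in (0 : ℝ)..T, u r ^ 2) / 2 / √(1 + eigen n)

theorem summable_modeBound_sq (T : ℝ) (u : ℝ → ℝ) (θ₀ : L2) :
    Summable fun n => modeBound T u θ₀ n ^ 2 := by
  set B := (1 + T + 2 * ∫ r in (0 : ℝ)..T, u r ^ 2) / 2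
  refine Summable.of_nonneg_of_le (fun n => sq_nonneg _) (fun n => ?_)
    (((hasSum_modeCoeff_sq θ₀).summable.mul_left 2).add
      (summable_one_add_eigen_inv.mul_left (2 * B ^ 2)))
  refine add_sq_le.trans_eq ?_
  rw [sq_abs, div_pow, Real.sq_sqrt (one_add_eigen_pos n).le]
  ring

theorem abs_heatMode_le (hu : MemLp u 2 (volume.restrict (Ioo (0 : ℝ) T))) (n : ℕ)
    (ht : t ∈ Icc 0 T) : |heatMode u θ₀ n t| ≤ modeBound T u θ₀ n := by
  have hT : 0 ≤ T := ht.1.trans ht.2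
  have husq : IntervalIntegrable (fun r => u r ^ 2) volume 0 T :=
    (intervalIntegrable_iff_integrableOn_Ioo_of_le hT).2 hu.integrable_sq
  have husqt : IntervalIntegrable (fun r => u r ^ 2) volume 0 t :=
    husq.mono_set (uIcc_subset_uIcc_left (Icc_subset_uIcc ht))
  have hmode : cosMode n 1 ^ 2 ≤ 2 := by
    simpa using pow_le_pow_left₀ (abs_nonneg _) (abs_cosMode_le n 1) 2
  refine (abs_modeSol_le_add (eigen_nonneg n) ht.1).trans (add_le_add_right ?_ _)
  rw [le_div_iff₀ (Real.sqrt_pos.2 (one_add_eigen_pos n)), mul_comm]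
  refine (sqrt_one_add_mul_abs_modeSol_le (eigen_nonneg n) ht.1 ?_).trans ?_
  · simpa only [mul_pow] using husqt.mul_const _
  · have hmono : ∫ r in (0 : ℝ)..t, u r ^ 2 ≤ ∫ r in (0 : ℝ)..T, u r ^ 2 :=
      intervalIntegral.integral_mono_interval le_rfl ht.1 ht.2
        (Eventually.of_forall fun r => sq_nonneg _) husq
    have hnonneg : 0 ≤ ∫ r in (0 : ℝ)..t, u r ^ 2 :=
      intervalIntegral.integral_nonneg ht.1 fun r _ => sq_nonneg _
    simp only [mul_pow]
    rw [intervalIntegral.integral_mul_const]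
    nlinarith [ht.2]

theorem continuousOn_heatMode (hu : MemLp u 2 (volume.restrict (Ioo (0 : ℝ) T))) (n : ℕ) :
    ContinuousOn (heatMode u θ₀ n) (Icc 0 T) := fun t ht =>
  ((continuousOn_modeSol ((intervalIntegrable_of_memLp hu
    (right_mem_Icc.2 (ht.1.trans ht.2))).mul_const _)).mono Icc_subset_uIcc) t ht

theorem exists_modeCoeff_eq_heatMode (hu : MemLp u 2 (volume.restrict (Ioo (0 : ℝ) T)))
    (θ₀ : L2) : ∃ θ : ℝ → L2, ∀ t ∈ Icc 0 T, ∀ n, modeCoeff (θ t) n = heatMode u θ₀ n t := by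
  have hmodes (t : ℝ) (ht : t ∈ Icc 0 T) : ∃ f : L2, ∀ n, modeCoeff f n = heatMode u θ₀ n t :=
    exists_modeCoeff_eq (Summable.of_nonneg_of_le (fun n => sq_nonneg _)
      (fun n => sq_le_sq' (abs_le.1 (abs_heatMode_le hu n ht)).1
        (abs_le.1 (abs_heatMode_le hu n ht)).2) (summable_modeBound_sq T u θ₀))
  choose! θ hθ using hmodes
  exact ⟨θ, hθ⟩

theorem IsNeumann.summable_abs_modeCoeff_deriv_deriv_mul (hφ : IsNeumann φ) {b : ℕ → ℝ}
    (hb : Summable fun n => b n ^ 2) :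
    Summable fun n => |modeCoeff (deriv (deriv φ)) n| * b n := by
  have hsq := (hasSum_modeCoeff_sq
    ((memLp_of_continuous hφ.continuous_deriv_deriv).toLp _)).summable
  simp only [modeCoeff_toLp] at hsq
  refine Summable.of_norm_bounded (hsq.add hb) fun n => ?_
  have hamgm := two_mul_le_add_sq |modeCoeff (deriv (deriv φ)) n| |b n|
  rw [sq_abs, sq_abs] at hamgm
  rw [norm_mul, Real.norm_eq_abs, Real.norm_eq_abs, abs_abs]
  nlinarith [mul_nonneg (abs_nonneg (modeCoeff (deriv (deriv φ)) n)) (abs_nonneg (b n))]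

theorem IsNeumann.hasSum_modeCoeff_mul_integral (hφ : IsNeumann φ)
    (hu : MemLp u 2 (volume.restrict (Ioo (0 : ℝ) T)))
    (hθ : ∀ t ∈ Icc 0 T, ∀ n, modeCoeff (θ t) n = heatMode u θ₀ n t) (ht : t ∈ Icc 0 T) :
    HasSum (fun n => modeCoeff φ n *
        ∫ r in (0 : ℝ)..t, (-eigen n * heatMode u θ₀ n r + u r * cosMode n 1))
      (∫ r in (0 : ℝ)..t,
        ((∫ x in Ioo (0 : ℝ) 1, θ r x * deriv (deriv φ) x) + u r * φ 1)) := by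
  have hut := intervalIntegrable_of_memLp hu ht
  have hA := hφ.summable_abs_modeCoeff_deriv_deriv_mul (summable_modeBound_sq T u θ₀)
  have hB := hφ.summable_abs_modeCoeff.mul_right √2
  have hsub : uIoc 0 t ⊆ Icc 0 T := by
    rw [uIoc_of_le ht.1]
    exact Ioc_subset_Icc_self.trans (Icc_subset_Icc_right ht.2)
  have hsplit (n : ℕ) (r : ℝ) :
      modeCoeff φ n * (-eigen n * heatMode u θ₀ n r + u r * cosMode n 1) =
        heatMode u θ₀ n r * modeCoeff (deriv (deriv φ)) n +
          u r * (modeCoeff φ n * cosMode n 1) := by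
    rw [hφ.modeCoeff_deriv_deriv]
    ring
  simp only [← intervalIntegral.integral_const_mul, hsplit]
  refine intervalIntegral.hasSum_integral_of_dominated_convergence
    (fun n r => |modeCoeff (deriv (deriv φ)) n| * modeBound T u θ₀ n +
      |modeCoeff φ n| * √2 * |u r|) (fun n => ?_)
    (fun n => Eventually.of_forall fun r hr => ?_)
    (Eventually.of_forall fun r _ => hA.add (hB.mul_right _)) ?_
    (Eventually.of_forall fun r hr => ?_)
  · exact ((((continuousOn_heatMode hu n).mono hsub).aestronglyMeasurable
      measurableSet_uIoc).mul_const _).add (hut.def'.aestronglyMeasurable.mul_const _)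
  · have hmode := abs_heatMode_le (θ₀ := θ₀) hu n (hsub hr)
    refine (norm_add_le _ _).trans (add_le_add ?_ ?_)
    · rw [norm_mul, mul_comm]
      exact mul_le_mul_of_nonneg_left hmode (abs_nonneg _)
    · rw [norm_mul, norm_mul, mul_comm]
      exact mul_le_mul_of_nonneg_right (mul_le_mul_of_nonneg_left (abs_cosMode_le n 1)
        (abs_nonneg _)) (abs_nonneg _)
  · simp only [fun r => (hA.tsum_add (hB.mul_right |u r|)), tsum_mul_right]
    exact intervalIntegrable_const.add (hut.abs.const_mul _)
  · have hinner := hasSum_modeCoeff_mul_modeCoeff (θ r) hφ.continuous_deriv_deriv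
    simp only [hθ r (hsub hr)] at hinner
    exact hinner.add ((hφ.hasSum_cosMode (right_mem_Icc.2 zero_le_one)).mul_left (u r))

theorem isHeatSolution_of_modeCoeff_eq_heatMode (hT : 0 ≤ T)
    (hu : MemLp u 2 (volume.restrict (Ioo (0 : ℝ) T)))
    (hθ : ∀ t ∈ Icc 0 T, ∀ n, modeCoeff (θ t) n = heatMode u θ₀ n t) :
    IsHeatSolution T u θ₀ θ where
  control_memLp := hu
  continuousOn := continuousOn_of_modeCoeff (summable_modeBound_sq T u θ₀)
    (fun n => (continuousOn_heatMode hu n).congr fun t ht => hθ t ht n)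
    fun n t ht => (hθ t ht n).symm ▸ abs_heatMode_le hu n ht
  initial := eq_of_modeCoeff_eq fun n =>
    (hθ 0 (left_mem_Icc.2 hT) n).trans modeSol_apply_zero
  weak φ hφ hφ₀ hφ₁ t ht := by
    have hN : IsNeumann φ := ⟨hφ, hφ₀, hφ₁⟩
    have hmode (n : ℕ) : modeCoeff (θ t) n * modeCoeff φ n =
        modeCoeff θ₀ n * modeCoeff φ n + modeCoeff φ n *
          ∫ r in (0 : ℝ)..t, (-eigen n * heatMode u θ₀ n r + u r * cosMode n 1) := by
      rw [hθ t ht, heatMode,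
        modeSol_eq_add_integral ((intervalIntegrable_of_memLp hu ht).mul_const _)]
      simp only [heatMode]
      ring
    have hsum := (hasSum_modeCoeff_mul_modeCoeff θ₀ hφ.continuous).add
      (hN.hasSum_modeCoeff_mul_integral hu hθ ht)
    simp only [← hmode] at hsum
    exact (hasSum_modeCoeff_mul_modeCoeff (θ t) hφ.continuous).unique hsum

theorem exists_isHeatSolution (hT : 0 ≤ T) (hu : MemLp u 2 (volume.restrict (Ioo (0 : ℝ) T)))
    (θ₀ : L2) : ∃ θ : ℝ → L2, IsHeatSolution T u θ₀ θ :=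
  (exists_modeCoeff_eq_heatMode hu θ₀).imp fun _ hθ =>
    isHeatSolution_of_modeCoeff_eq_heatMode hT hu hθ

end Existence

namespace IsHeatSolution

variable {T t : ℝ} {u u' : ℝ → ℝ} {θ₀ : L2} {θ θ' : ℝ → L2}

theorem continuousOn_modeCoeff (hθ : IsHeatSolution T u θ₀ θ) (n : ℕ) :
    ContinuousOn (fun t => modeCoeff (θ t) n) (Icc 0 T) := by
  simp only [← inner_cosBasis]
  exact continuousOn_const.inner hθ.continuousOn

theorem modeCoeff_eq_add_integral (hθ : IsHeatSolution T u θ₀ θ) (n : ℕ) (ht : t ∈ Icc 0 T) :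
    modeCoeff (θ t) n = modeCoeff θ₀ n +
      ∫ r in (0 : ℝ)..t, (-eigen n * modeCoeff (θ r) n + u r * cosMode n 1) := by
  have hN := isNeumann_cosMode n
  have hweak := hθ.weak (cosMode n) hN.contDiff hN.deriv_zero hN.deriv_one t ht
  simp only [(hasDerivAt_deriv_cosMode n _).deriv, mul_left_comm _ (-eigen n),
    integral_const_mul] at hweak
  exact hweak

theorem modeCoeff_eq_heatMode (hθ : IsHeatSolution T u θ₀ θ) (n : ℕ) (ht : t ∈ Icc 0 T) :
    modeCoeff (θ t) n = heatMode u θ₀ n t := by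
  have hsub : uIcc 0 t ⊆ Icc 0 T := by
    rw [uIcc_of_le ht.1]
    exact Icc_subset_Icc_right ht.2
  exact eq_modeSol ((intervalIntegrable_of_memLp hθ.control_memLp ht).mul_const _)
    ((hθ.continuousOn_modeCoeff n).mono hsub)
    fun r hr => hθ.modeCoeff_eq_add_integral n (hsub hr)

theorem abs_modeCoeff_sub_le {ε : ℝ} (hθ : IsHeatSolution T u θ₀ θ)
    (hθ' : IsHeatSolution T u' θ₀ θ') (hε : ∀ r ∈ Icc 0 T, |u r - u' r| ≤ ε) (n : ℕ)
    (ht : t ∈ Icc 0 T) :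
    |modeCoeff (θ t - θ' t : L2) n| ≤ √2 * ε * (1 + T) * (1 + eigen n)⁻¹ := by
  have hε0 : 0 ≤ ε := (abs_nonneg _).trans (hε t ht)
  have hbound (r : ℝ) (hr : r ∈ Ioc 0 t) : |u r * cosMode n 1 - u' r * cosMode n 1| ≤ ε * √2 := by
    rw [← sub_mul, abs_mul]
    exact mul_le_mul (hε r ⟨hr.1.le, hr.2.trans ht.2⟩) (abs_cosMode_le n 1) (abs_nonneg _) hε0
  rw [modeCoeff_sub, hθ.modeCoeff_eq_heatMode n ht, hθ'.modeCoeff_eq_heatMode n ht, heatMode,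
    heatMode, modeSol_sub ((intervalIntegrable_of_memLp hθ.control_memLp ht).mul_const _)
      ((intervalIntegrable_of_memLp hθ'.control_memLp ht).mul_const _),
    ← div_eq_mul_inv, le_div_iff₀' (one_add_eigen_pos n)]
  calc (1 + eigen n) * |modeSol (eigen n) 0 (fun r => u r * cosMode n 1 - u' r * cosMode n 1) t|
      ≤ (1 + t) * (ε * √2) :=
        one_add_mul_abs_modeSol_le (eigen_nonneg n) ht.1 hbound (by positivity)
    _ ≤ (1 + T) * (ε * √2) := by
        gcongr
        exact ht.2
    _ = √2 * ε * (1 + T) := by ring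

theorem eLpNorm_sub_le {ε : ℝ} (hθ : IsHeatSolution T u θ₀ θ) (hθ' : IsHeatSolution T u' θ₀ θ')
    (hε : ∀ r ∈ Icc 0 T, |u r - u' r| ≤ ε) (ht : t ∈ Icc 0 T) :
    eLpNorm (fun x => θ t x - θ' t x) ⊤ unitMeasure ≤
      ENNReal.ofReal (2 * (1 + T) * (∑' n, (1 + eigen n)⁻¹) * ε) := by
  have hmodes := fun n => hθ.abs_modeCoeff_sub_le hθ' hε n ht
  have hmajor := summable_one_add_eigen_inv.mul_left (√2 * ε * (1 + T))
  have hsum : Summable fun n => |modeCoeff (θ t - θ' t : L2) n| :=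
    hmajor.of_nonneg_of_le (fun n => abs_nonneg _) hmodes
  have htsum := hsum.tsum_le_tsum hmodes hmajor
  rw [tsum_mul_left] at htsum
  refine (eLpNorm_congr_ae (Lp.coeFn_sub (θ t) (θ' t)).symm).trans_le ?_
  refine (eLpNorm_top_le_tsum_abs_modeCoeff hsum).trans (ENNReal.ofReal_le_ofReal ?_)
  calc √2 * ∑' n, |modeCoeff (θ t - θ' t : L2) n|
      ≤ √2 * (√2 * ε * (1 + T) * ∑' n, (1 + eigen n)⁻¹) := by gcongr
    _ = √2 * √2 * (1 + T) * (∑' n, (1 + eigen n)⁻¹) * ε := by ring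
    _ = _ := by rw [Real.mul_self_sqrt zero_le_two]

end IsHeatSolution

theorem corollary3_general (T τ R' s : ℝ) (hR' : 0 < R') (hR'τ : R' < τ) (hT : 0 ≤ T)
    (hs₁ : 1 < s) (hs₂ : s < 2) :
    ∃ C C₁ C₂ C₃ : ℝ, 0 < C ∧ 0 < C₁ ∧ 0 < C₂ ∧ 0 < C₃ ∧
      ∀ θ₀ : L2,
        ControlWellDefined T s τ R' θ₀ ∧
        (∃ θ : ℝ → L2, IsHeatSolution T (control s τ R' θ₀) θ₀ θ) ∧
        ∀ I K N : ℕ,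
          (∃ θ' : ℝ → L2, IsHeatSolution T (truncControl s τ R' θ₀ I K N) θ₀ θ') ∧
          ∀ θ θ' : ℝ → L2,
            IsHeatSolution T (control s τ R' θ₀) θ₀ θ →
            IsHeatSolution T (truncControl s τ R' θ₀ I K N) θ₀ θ' →
            ∀ t ∈ Icc τ T,
              eLpNorm (fun x => θ t x - θ' t x) ⊤ unitMeasure ≤
                ENNReal.ofReal
                  (C * (Real.exp (-C₁ * ((I : ℝ) * Real.log (I : ℝ))) +
                        Real.exp (-C₂ * (K : ℝ)) + Real.exp (-C₃ * (N : ℝ) ^ 2)) * ‖θ₀‖) := by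
  obtain ⟨C, C₁, C₂, C₃, hC, hC₁, hC₂, hC₃, hdiff⟩ :=
    exists_abs_control_sub_truncControl_le hs₁ hs₂ hR' hR'τ
  have hgain : 0 < ∑' n, (1 + eigen n)⁻¹ :=
    summable_one_add_eigen_inv.tsum_pos (fun n => (inv_pos.2 (one_add_eigen_pos n)).le) 0
      (inv_pos.2 (one_add_eigen_pos 0))
  refine ⟨2 * (1 + T) * (∑' n, (1 + eigen n)⁻¹) * C, C₁, C₂, C₃, by positivity, hC₁, hC₂, hC₃,
    fun θ₀ => ⟨controlWellDefined T θ₀ hs₁ hs₂ hR' hR'τ,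
      exists_isHeatSolution hT (memLp_control T θ₀ hs₁ hs₂ hR' hR'τ) θ₀, fun I K N =>
      ⟨exists_isHeatSolution hT (memLp_truncControl T τ R' θ₀ hs₁ I K N) θ₀, ?_⟩⟩⟩
  intro θ θ' hθ hθ' t ht
  have ht₀ : t ∈ Icc 0 T := ⟨(hR'.trans hR'τ).le.trans ht.1, ht.2⟩
  refine (hθ.eLpNorm_sub_le hθ' (fun r _ => hdiff θ₀ I K N r) ht₀).trans_eq ?_
  congr 1
  ring

end HeatFlat

end

theorem corollary3 (T τ R' s : ℝ) (hτ : 0 < τ) (hR' : 0 < R') (hR'τ : R' < τ) (hT : τ + R' ≤ T)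
    (hs₁ : 1 < s) (hs₂ : s < 2) :
    ∃ C C₁ C₂ C₃ : ℝ, 0 < C ∧ 0 < C₁ ∧ 0 < C₂ ∧ 0 < C₃ ∧
      ∀ θ₀ : HeatFlat.L2,
        HeatFlat.ControlWellDefined T s τ R' θ₀ ∧
        (∃ θ : ℝ → HeatFlat.L2,
          HeatFlat.IsHeatSolution T (HeatFlat.control s τ R' θ₀) θ₀ θ) ∧
        ∀ I K N : ℕ,
          (∃ θ' : ℝ → HeatFlat.L2,
            HeatFlat.IsHeatSolution T (HeatFlat.truncControl s τ R' θ₀ I K N) θ₀ θ') ∧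
          ∀ θ θ' : ℝ → HeatFlat.L2,
            HeatFlat.IsHeatSolution T (HeatFlat.control s τ R' θ₀) θ₀ θ →
            HeatFlat.IsHeatSolution T (HeatFlat.truncControl s τ R' θ₀ I K N) θ₀ θ' →
            ∀ t ∈ Set.Icc τ T,
              MeasureTheory.eLpNorm (fun x => θ t x - θ' t x) ⊤ HeatFlat.unitMeasure ≤
                ENNReal.ofReal
                  (C * (Real.exp (-C₁ * ((I : ℝ) * Real.log (I : ℝ))) +
                        Real.exp (-C₂ * (K : ℝ)) + Real.exp (-C₃ * (N : ℝ) ^ 2)) * ‖θ₀‖) :=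
  HeatFlat.corollary3_general T τ R' s hR' hR'τ (by linarith) hs₁ hs₂
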